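/- \textbf{Theorem (Ledoux isoperimetric inequality).} Let $C_1\ge 1$. There is a constant $C_{\mathrm{ledoux}}>0$ depending only on $C_1$ such that the following holds. Let $(X,d)$ be a compact metric space with a Borel probability measure $\mu$ that is positive on non-empty open sets, and let $(\mathcal E,\operatorname{Dom}\mathcal E)$ be a symmetric, strictly local, regular Dirichlet form on $L^2(X,\mu)$ which admits a carré du champ $\Gamma$, normalized so that $2\int h\,\Gamma(f,g)\,d\mu=\mathcal E(fh,g)+\mathcal E(gh,f)-\mathcal E(fg,h)$ for bounded $f,g,h\in\operatorname{Dom}\mathcal E$; write $\Gamma(f)=\Gamma(f,f)$. Let $\Delta$ be its generator, $\mathcal E(u,v)=-\int v\,\Delta u\,d\mu$, and $P_t=e^{t\Delta}$ the heat semigroup. Assume that (i) $\mathcal E$ satisfies a log-Sobolev inequality: for some $\rho>0$, $$\int f^2\ln f^2\,d\mu-\int f^2\,d\mu\,\ln\int f^2\,d\mu\le\frac1{\rho}\int\Gamma(f)\,d\mu,\qquad f\in\operatorname{Dom}\mathcal E;$$ let $\rho_0\in(0,\infty]$ be the supremum of all such $\rho$ (the log-Sobolev constant); (ii) the weak Bakry--Émery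 estimate holds with $C_2=0$: for all $f\in\operatorname{Dom}\mathcal E$ and $t\ge0$, $\sqrt{\Gamma(P_tf)}\le C_1\,P_t\sqrt{\Gamma(f)}$ $\mu$-almost everywhere. Then $$\rho_0\le C_{\mathrm{ledoux}}\,k^2,\qquad k=\inf\left\{\frac{P(E)}{\mu(E)\sqrt{-\ln\mu(E)}}\;:\;E\subset X\text{ Borel},\ P(E)<\infty,\ 0<\mu(E)\le\tfrac12\right\}\in[0,\infty],$$ with $\inf\emptyset=\infty$. Here $P(E)=\operatorname{Var}\mathbf 1_E$ and $$\operatorname{Var}f=\sup\{\langle f,\partial^*\eta\rangle_{L^2}:\eta\in\operatorname{Dom}\partial^*,\ \|\eta\|_{\mathcal H_x}\le1\text{ for }\mu\text{-a.e. }x\},$$ where $\mathcal H$ is the Hilbert space of one-forms, i.e. the Hausdorff completion of the span of simple tensors $f\otimes g$ ($f\in\operatorname{Dom}\mathcal E$, $g$ bounded Borel) for the scalar product $\langle f_1\otimes g_1,f_2\otimes g_2\rangle=\int g_1g_2\,\Gamma(f_1,f_2)\,d\mu$; $\|\cdot\|_{\mathcal H_x}$ is the fibre norm, the continuous extension to $\mathcal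 H$ of $\|\sum_i f_i\otimes g_i\|_{\mathcal H_x}^2=\sum_{i,j}g_i(x)g_j(x)\Gamma(f_i,f_j)(x)$; and $\partial^*$ is the adjoint of $\partial f=f\otimes\mathbf 1$, $f\in\operatorname{Dom}\mathcal E$. -/

import Mathlib

open MeasureTheory Filter Topology
open scoped ENNReal TensorProduct

universe u

noncomputable section

/-- A symmetric Dirichlet form on `L²(X, μ)`: a densely defined, symmetric, nonnegative, closed
bilinear form on which the unit contraction `u ↦ min (max u 0) 1` operates. -/
structure DirichletForm {X : Type u} [MeasurableSpace X] (μ : Measure X) where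
  /-- the domain `Dom ℰ` -/
  domain : Submodule ℝ (Lp ℝ 2 μ)
  /-- the form `ℰ` -/
  form : domain →ₗ[ℝ] domain →ₗ[ℝ] ℝ
  dense : Dense (domain : Set (Lp ℝ 2 μ))
  symm : ∀ u v : domain, form u v = form v u
  nonneg : ∀ u : domain, 0 ≤ form u u
  closed : ∀ u : ℕ → domain,
    (∀ ε : ℝ, 0 < ε → ∃ N : ℕ, ∀ m ≥ N, ∀ n ≥ N,
      form (u m - u n) (u m - u n) + ‖u m - u n‖ ^ 2 < ε) →
    ∃ v : domain,
      Tendsto (fun n => form (u n - v) (u n - v) + ‖u n - v‖ ^ 2) atTop (𝓝 0)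
  markov : ∀ u : domain, ∃ v : domain,
    ((v : Lp ℝ 2 μ) : X → ℝ) =ᵐ[μ] (fun x => min (max ((u : Lp ℝ 2 μ) x) 0) 1) ∧
      form v v ≤ form u u

namespace DirichletForm

variable {X : Type u} [MeasurableSpace X] {μ : Measure X} (E : DirichletForm μ)

/-! ### Regularity and strict locality -/

/-- `u ∈ Dom ℰ` has a continuous compactly supported representative `φ`. -/
def IsCoreFunction [TopologicalSpace X] (u : E.domain) (φ : X → ℝ) : Prop :=
  Continuous φ ∧ HasCompactSupport φ ∧ ((u : Lp ℝ 2 μ) : X → ℝ) =ᵐ[μ] φ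

/-- `ℰ` is regular: `C_c(X) ∩ Dom ℰ` is dense in `Dom ℰ` for the norm
`(ℰ(u,u) + ‖u‖²)^{1/2}` and dense in `C_c(X)` for the uniform norm. -/
def IsRegular [TopologicalSpace X] : Prop :=
  (∀ u : E.domain, ∀ ε : ℝ, 0 < ε → ∃ (v : E.domain) (φ : X → ℝ), E.IsCoreFunction v φ ∧
      E.form (u - v) (u - v) + ‖u - v‖ ^ 2 < ε) ∧
  (∀ ψ : X → ℝ, Continuous ψ → HasCompactSupport ψ → ∀ ε : ℝ, 0 < ε →
      ∃ (v : E.domain) (φ : X → ℝ), E.IsCoreFunction v φ ∧ ∀ x, |ψ x - φ x| < ε)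

/-- `ℰ` is strictly (strongly) local: `ℰ(u,v) = 0` whenever `u, v ∈ Dom ℰ` have compact support
and `v` is constant on a neighbourhood of the support of `u`. -/
def IsStrictlyLocal [TopologicalSpace X] : Prop :=
  ∀ (u v : E.domain) (K L U : Set X) (c : ℝ), IsCompact K → IsClosed K → IsCompact L →
    IsClosed L → IsOpen U → K ⊆ U →
    (∀ᵐ x ∂μ, x ∉ K → (u : Lp ℝ 2 μ) x = 0) →
    (∀ᵐ x ∂μ, x ∉ L → (v : Lp ℝ 2 μ) x = 0) →
    (∀ᵐ x ∂μ, x ∈ U → (v : Lp ℝ 2 μ) x = c) →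
    E.form u v = 0

/-! ### The resolvent and the heat semigroup

The generator `Δ` is the self-adjoint operator with `ℰ(u,v) = -⟪Δ u, v⟫` for `u ∈ Dom Δ` and
`v ∈ Dom ℰ`.  For `α > 0` the resolvent `(α - Δ)⁻¹ f` is the `u ∈ Dom ℰ` with
`α ⟪u,v⟫ + ℰ(u,v) = ⟪f,v⟫` for all `v ∈ Dom ℰ`. -/

/-- A copy of `Dom ℰ`, carrying the inner product `α ⟪u,v⟫ + ℰ(u,v)`. -/
def FormSpace (E : DirichletForm μ) (_α : Set.Ioi (0 : ℝ)) : Type u := E.domain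

instance (α : Set.Ioi (0 : ℝ)) : AddCommGroup (E.FormSpace α) :=
  inferInstanceAs (AddCommGroup E.domain)

instance (α : Set.Ioi (0 : ℝ)) : Module ℝ (E.FormSpace α) :=
  inferInstanceAs (Module ℝ E.domain)

/-- The identity from `FormSpace` to `Dom ℰ`. -/
def FormSpace.out (α : Set.Ioi (0 : ℝ)) : E.FormSpace α →ₗ[ℝ] E.domain :=
  (LinearMap.id : E.domain →ₗ[ℝ] E.domain)

/-- The inner product `α ⟪u,v⟫ + ℰ(u,v)`. -/
@[reducible] def formCore (α : Set.Ioi (0 : ℝ)) :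
    InnerProductSpace.Core ℝ (E.FormSpace α) where
  inner u v := α.1 * inner ℝ (FormSpace.out E α u) (FormSpace.out E α v)
    + E.form (FormSpace.out E α u) (FormSpace.out E α v)
  conj_inner_symm u v := by
    simp only [conj_trivial]
    rw [real_inner_comm, E.symm]
  re_inner_nonneg u := by
    have h1 := E.nonneg (FormSpace.out E α u)
    have h2 : 0 ≤ inner ℝ (FormSpace.out E α u) (FormSpace.out E α u) := real_inner_self_nonneg
    have h3 : (0 : ℝ) < α.1 := α.2
    simp only [RCLike.re_to_real]
    positivity
  add_left u v w := by
    simp only [map_add, inner_add_left, LinearMap.add_apply]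
    ring
  smul_left u v r := by
    have h : inner ℝ (r • FormSpace.out E α u) (FormSpace.out E α v)
        = r * inner ℝ (FormSpace.out E α u) (FormSpace.out E α v) :=
      real_inner_smul_left (F := E.domain) _ _ _
    simp only [map_smul, LinearMap.smul_apply, smul_eq_mul, conj_trivial]
    rw [h]
    ring
  definite u h := by
    have h1 := E.nonneg (FormSpace.out E α u)
    have h2 : 0 ≤ inner ℝ (FormSpace.out E α u) (FormSpace.out E α u) := real_inner_self_nonneg
    have h3 : (0 : ℝ) < α.1 := α.2
    have h4 : inner ℝ (FormSpace.out E α u) (FormSpace.out E α u) = 0 := by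
      by_contra hne
      have h5 : 0 < inner ℝ (FormSpace.out E α u) (FormSpace.out E α u) :=
        lt_of_le_of_ne h2 (Ne.symm hne)
      have := mul_pos h3 h5
      linarith
    exact inner_self_eq_zero.1 h4

instance (α : Set.Ioi (0 : ℝ)) : NormedAddCommGroup (E.FormSpace α) :=
  @InnerProductSpace.Core.toNormedAddCommGroup ℝ _ _ _ _ (E.formCore α)

instance (α : Set.Ioi (0 : ℝ)) : InnerProductSpace ℝ (E.FormSpace α) :=
  InnerProductSpace.ofCore (E.formCore α).toCore

theorem FormSpace.inner_def (α : Set.Ioi (0 : ℝ)) (u v : E.FormSpace α) :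
    inner ℝ u v = α.1 * inner ℝ (FormSpace.out E α u) (FormSpace.out E α v)
      + E.form (FormSpace.out E α u) (FormSpace.out E α v) := rfl

theorem FormSpace.norm_sq (α : Set.Ioi (0 : ℝ)) (u : E.FormSpace α) :
    ‖u‖ ^ 2 = α.1 * ‖FormSpace.out E α u‖ ^ 2
      + E.form (FormSpace.out E α u) (FormSpace.out E α u) := by
  rw [← real_inner_self_eq_norm_sq, FormSpace.inner_def, real_inner_self_eq_norm_sq]

instance (α : Set.Ioi (0 : ℝ)) : CompleteSpace (E.FormSpace α) := by
  have hα : (0 : ℝ) < α.1 := α.2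
  apply Metric.complete_of_cauchySeq_tendsto
  intro u hu
  rw [Metric.cauchySeq_iff] at hu
  have hcmp : ∀ w : E.FormSpace α, E.form (FormSpace.out E α w) (FormSpace.out E α w)
      + ‖FormSpace.out E α w‖ ^ 2 ≤ (1 + 1 / α.1) * ‖w‖ ^ 2 := by
    intro w
    rw [FormSpace.norm_sq]
    have h1 := E.nonneg (FormSpace.out E α w)
    have h2 : 0 ≤ ‖FormSpace.out E α w‖ ^ 2 := by positivity
    have h3 : 0 ≤ 1 / α.1 * E.form (FormSpace.out E α w) (FormSpace.out E α w) := by positivity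
    have h4 : 0 ≤ α.1 * ‖FormSpace.out E α w‖ ^ 2 := by positivity
    have h5 : (1 / α.1) * (α.1 * ‖FormSpace.out E α w‖ ^ 2) = ‖FormSpace.out E α w‖ ^ 2 := by
      field_simp
    nlinarith
  obtain ⟨v, hv⟩ := E.closed (fun n => FormSpace.out E α (u n)) (by
    intro ε hε
    obtain ⟨N, hN⟩ := hu (Real.sqrt (ε / (1 + 1 / α.1))) (by positivity)
    refine ⟨N, fun m hm n hn => ?_⟩
    have h1 := hN m hm n hn
    rw [dist_eq_norm] at h1
    have h2 : ‖u m - u n‖ ^ 2 < ε / (1 + 1 / α.1) := by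
      rw [← Real.lt_sqrt (norm_nonneg _)]
      exact h1
    rw [lt_div_iff₀ (by positivity)] at h2
    have h3 := hcmp (u m - u n)
    rw [map_sub] at h3
    linarith)
  refine ⟨(show E.FormSpace α from v), ?_⟩
  rw [tendsto_iff_norm_sub_tendsto_zero]
  have hsq : Tendsto (fun n => ‖u n - (show E.FormSpace α from v)‖ ^ 2) atTop (𝓝 0) := by
    have hb := hv.const_mul (1 + α.1)
    rw [mul_zero] at hb
    refine squeeze_zero (fun n => by positivity) (fun n => ?_) hb
    rw [FormSpace.norm_sq, map_sub]
    have h1 := E.nonneg (FormSpace.out E α (u n) - v)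
    have h2 : 0 ≤ ‖FormSpace.out E α (u n) - v‖ ^ 2 := by positivity
    have h3 := mul_nonneg hα.le h1
    change α.1 * ‖FormSpace.out E α (u n) - v‖ ^ 2
      + E.form (FormSpace.out E α (u n) - v) (FormSpace.out E α (u n) - v) ≤ _
    nlinarith
  have := hsq.sqrt
  simpa [Real.sqrt_sq (norm_nonneg _)] using this

theorem norm_out_le (α : Set.Ioi (0 : ℝ)) (u : E.FormSpace α) :
    ‖FormSpace.out E α u‖ ≤ Real.sqrt (1 / α.1) * ‖u‖ := by
  have hα : (0 : ℝ) < α.1 := α.2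
  rw [← Real.sqrt_sq (norm_nonneg u), ← Real.sqrt_mul (by positivity)]
  apply Real.le_sqrt_of_sq_le
  rw [FormSpace.norm_sq]
  have h1 := E.nonneg (FormSpace.out E α u)
  have h3 : 0 ≤ 1 / α.1 * E.form (FormSpace.out E α u) (FormSpace.out E α u) := by positivity
  have h5 : (1 / α.1) * (α.1 * ‖FormSpace.out E α u‖ ^ 2) = ‖FormSpace.out E α u‖ ^ 2 := by
    field_simp
  nlinarith

/-- The bounded inclusion of `Dom ℰ`, with the norm `(α ‖u‖² + ℰ(u,u))^{1/2}`, into `L²`. -/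
def formInclusion (α : Set.Ioi (0 : ℝ)) : E.FormSpace α →L[ℝ] Lp ℝ 2 μ :=
  (E.domain.subtype ∘ₗ FormSpace.out E α).mkContinuous (Real.sqrt (1 / α.1))
    (fun u => E.norm_out_le α u)

/-- The resolvent `(α - Δ)⁻¹`, `α > 0`: if `ι` is the inclusion of `Dom ℰ` into `L²` then
`(α - Δ)⁻¹ = ι ι*`, the adjoint being taken for the inner product `α ⟪u,v⟫ + ℰ(u,v)`. -/
def resolvent (α : Set.Ioi (0 : ℝ)) : Lp ℝ 2 μ →L[ℝ] Lp ℝ 2 μ :=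
  (E.formInclusion α) ∘L (ContinuousLinearMap.adjoint (E.formInclusion α))

/-- The defining property of the resolvent. -/
theorem resolvent_spec (α : Set.Ioi (0 : ℝ)) (f : Lp ℝ 2 μ) :
    ∃ u : E.domain, (u : Lp ℝ 2 μ) = E.resolvent α f ∧
      ∀ v : E.domain, α.1 * inner ℝ (u : Lp ℝ 2 μ) (v : Lp ℝ 2 μ) + E.form u v
        = inner ℝ f (v : Lp ℝ 2 μ) :=
  ⟨FormSpace.out E α (ContinuousLinearMap.adjoint (E.formInclusion α) f), rfl, fun v =>
    ContinuousLinearMap.adjoint_inner_left (E.formInclusion α)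
      (show E.FormSpace α from v) f⟩

/-- The Yosida approximation `α Δ (α - Δ)⁻¹ = α (α (α - Δ)⁻¹ - 1)` of `Δ`. -/
def yosida (α : Set.Ioi (0 : ℝ)) : Lp ℝ 2 μ →L[ℝ] Lp ℝ 2 μ :=
  α.1 • (α.1 • E.resolvent α - ContinuousLinearMap.id ℝ (Lp ℝ 2 μ))

/-- The heat semigroup `P_t f = e^{tΔ} f`, `t ≥ 0`, as the limit of `exp(t Δ_n) f`, where `Δ_n` are
the (bounded) Yosida approximations of `Δ`. -/
def heat (t : ℝ) (f : Lp ℝ 2 μ) : Lp ℝ 2 μ :=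
  limUnder atTop (fun n : ℕ =>
    NormedSpace.exp (t • E.yosida ⟨(n : ℝ) + 1, Set.mem_Ioi.2 (Nat.cast_add_one_pos n)⟩) f)

end DirichletForm

/-! ### The carré du champ -/

/-- A carré du champ of the Dirichlet form `ℰ`: a symmetric, nonnegative, continuous bilinear map
`Γ : Dom ℰ × Dom ℰ → L¹(μ)` such that
`2 ∫ h Γ(f,g) dμ = ℰ(fh,g) + ℰ(gh,f) - ℰ(fg,h)` for bounded `f, g, h ∈ Dom ℰ`.
There is at most one such map. -/
structure CarreDuChamp {X : Type u} [MeasurableSpace X] {μ : Measure X}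
    (E : DirichletForm μ) where
  /-- the bilinear map `Γ` -/
  gamma : E.domain →ₗ[ℝ] E.domain →ₗ[ℝ] Lp ℝ 1 μ
  symm : ∀ f g : E.domain, gamma f g = gamma g f
  nonneg : ∀ f : E.domain, ∀ᵐ x ∂μ, 0 ≤ gamma f f x
  continuous : ∃ M : ℝ, ∀ f : E.domain, ‖gamma f f‖ ≤ M * (E.form f f + ‖f‖ ^ 2)
  integral_eq : ∀ f g h fg fh gh : E.domain,
    (∃ M : ℝ, ∀ᵐ x ∂μ, |(f : Lp ℝ 2 μ) x| ≤ M) →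
    (∃ M : ℝ, ∀ᵐ x ∂μ, |(g : Lp ℝ 2 μ) x| ≤ M) →
    (∃ M : ℝ, ∀ᵐ x ∂μ, |(h : Lp ℝ 2 μ) x| ≤ M) →
    (∀ᵐ x ∂μ, (fg : Lp ℝ 2 μ) x = (f : Lp ℝ 2 μ) x * (g : Lp ℝ 2 μ) x) →
    (∀ᵐ x ∂μ, (fh : Lp ℝ 2 μ) x = (f : Lp ℝ 2 μ) x * (h : Lp ℝ 2 μ) x) →
    (∀ᵐ x ∂μ, (gh : Lp ℝ 2 μ) x = (g : Lp ℝ 2 μ) x * (h : Lp ℝ 2 μ) x) →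
    2 * ∫ x, (h : Lp ℝ 2 μ) x * gamma f g x ∂μ = E.form fh g + E.form gh f - E.form fg h

/-! ### Bounded Borel functions -/

/-- The algebra of bounded measurable functions on `X`. -/
def boundedMeasurable (X : Type u) [MeasurableSpace X] : Subalgebra ℝ (X → ℝ) where
  carrier := {g | Measurable g ∧ ∃ M : ℝ, ∀ x, |g x| ≤ M}
  mul_mem' := by
    rintro f g ⟨hf, M, hM⟩ ⟨hg, N, hN⟩
    refine ⟨hf.mul hg, M * N, fun x => ?_⟩
    rw [Pi.mul_apply, abs_mul]
    exact mul_le_mul (hM x) (hN x) (abs_nonneg _) ((abs_nonneg _).trans (hM x))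
  add_mem' := by
    rintro f g ⟨hf, M, hM⟩ ⟨hg, N, hN⟩
    exact ⟨hf.add hg, M + N, fun x => (abs_add_le _ _).trans (add_le_add (hM x) (hN x))⟩
  algebraMap_mem' := fun r => ⟨measurable_const, |r|, fun _ => le_rfl⟩

namespace boundedMeasurable

variable {X : Type u} [MeasurableSpace X] {μ : Measure X}

theorem integrable_mul (g : boundedMeasurable X) (γ : Lp ℝ 1 μ) :
    Integrable (fun x => g.1 x * γ x) μ := by
  obtain ⟨hg, M, hM⟩ := g.2
  exact (L1.integrable_coeFn γ).bdd_mul (c := M) hg.aestronglyMeasurable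
    (Eventually.of_forall hM)

/-- Multiplication of an integrable function by a bounded measurable one. -/
def mulL1 (μ : Measure X) : Lp ℝ 1 μ →ₗ[ℝ] boundedMeasurable X →ₗ[ℝ] Lp ℝ 1 μ :=
  LinearMap.mk₂ ℝ (fun γ g => (integrable_mul g γ).toL1 _)
    (fun γ₁ γ₂ g => by
      rw [← Integrable.toL1_add, Integrable.toL1_eq_toL1_iff]
      filter_upwards [Lp.coeFn_add γ₁ γ₂] with x hx
      simp only [hx, Pi.add_apply]
      ring)
    (fun c γ g => by
      rw [← Integrable.toL1_smul, Integrable.toL1_eq_toL1_iff]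
      filter_upwards [Lp.coeFn_smul c γ] with x hx
      simp only [hx, Pi.smul_apply, smul_eq_mul]
      ring)
    (fun γ g₁ g₂ => by
      rw [← Integrable.toL1_add, Integrable.toL1_eq_toL1_iff]
      exact Eventually.of_forall fun x => add_mul _ _ _)
    (fun c γ g => by
      rw [← Integrable.toL1_smul, Integrable.toL1_eq_toL1_iff]
      exact Eventually.of_forall fun x => mul_assoc _ _ _)

theorem mulL1_coe (γ : Lp ℝ 1 μ) (g : boundedMeasurable X) :
    ∀ᵐ x ∂μ, mulL1 μ γ g x = g.1 x * γ x :=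
  Integrable.coeFn_toL1 (integrable_mul g γ)

end boundedMeasurable

namespace CarreDuChamp

variable {X : Type u} [MeasurableSpace X] {μ : Measure X} {E : DirichletForm μ}
  (Γ : CarreDuChamp E)

/-! ### The Hilbert space of one-forms -/

/-- The space `Dom ℰ ⊗ 𝓑_b(X)` spanned by the simple one-forms `f ⊗ g`. -/
def SimpleForm (_Γ : CarreDuChamp E) : Type u := E.domain ⊗[ℝ] boundedMeasurable X

instance : AddCommGroup Γ.SimpleForm :=
  inferInstanceAs (AddCommGroup (E.domain ⊗[ℝ] boundedMeasurable X))

instance : Module ℝ Γ.SimpleForm :=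
  inferInstanceAs (Module ℝ (E.domain ⊗[ℝ] boundedMeasurable X))

/-- The simple one-form `f ⊗ g`. -/
def tmul (f : E.domain) (g : boundedMeasurable X) : Γ.SimpleForm := f ⊗ₜ[ℝ] g

/-- The pointwise inner product of simple one-forms, the bilinear extension of
`⟪f₁ ⊗ g₁, f₂ ⊗ g₂⟫_x = g₁(x) g₂(x) Γ(f₁,f₂)(x)`. -/
def fiberInner : Γ.SimpleForm →ₗ[ℝ] Γ.SimpleForm →ₗ[ℝ] Lp ℝ 1 μ :=
  (LinearMap.BilinMap.tmul Γ.gamma (LinearMap.mul ℝ (boundedMeasurable X))).compr₂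
    (TensorProduct.lift (boundedMeasurable.mulL1 μ))

theorem fiberInner_tmul (f₁ f₂ : E.domain) (g₁ g₂ : boundedMeasurable X) :
    Γ.fiberInner (Γ.tmul f₁ g₁) (Γ.tmul f₂ g₂)
      = boundedMeasurable.mulL1 μ (Γ.gamma f₁ f₂) (g₁ * g₂) := by
  rfl

theorem fiberInner_symm (ω η : Γ.SimpleForm) : Γ.fiberInner ω η = Γ.fiberInner η ω := by
  have h := LinearMap.BilinMap.tmul_isSymm (B₁ := Γ.gamma)
    (B₂ := LinearMap.mul ℝ (boundedMeasurable X)) Γ.symm (fun a b => mul_comm a b) ω η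
  exact congrArg (TensorProduct.lift (boundedMeasurable.mulL1 μ)) h

theorem fiberInner_nonneg (ω : Γ.SimpleForm) : ∀ᵐ x ∂μ, 0 ≤ Γ.fiberInner ω ω x := by
  obtain ⟨n, f, g, rfl⟩ : ∃ (n : ℕ) (f : Fin n → E.domain) (g : Fin n → boundedMeasurable X),
      ω = ∑ i, Γ.tmul (f i) (g i) := by
    obtain ⟨S, hS⟩ := TensorProduct.exists_finset (R := ℝ) (M := E.domain)
      (N := boundedMeasurable X) ω
    refine ⟨S.card, fun i => (S.equivFin.symm i).1.1, fun i => (S.equivFin.symm i).1.2, ?_⟩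
    rw [hS, ← Finset.sum_coe_sort, ← Equiv.sum_comp S.equivFin.symm]
    rfl
  -- pointwise, the quadratic form in the coefficients is given by the matrix `Γ(f_i, f_j)(x)`
  have hsum : ∀ c : Fin n → ℚ, ∀ᵐ x ∂μ,
      0 ≤ ∑ i, ∑ j, (c i : ℝ) * (c j : ℝ) * Γ.gamma (f i) (f j) x := by
    intro c
    have h0 := Γ.nonneg (∑ i, (c i : ℝ) • f i)
    have h1 : Γ.gamma (∑ i, (c i : ℝ) • f i) (∑ i, (c i : ℝ) • f i)
        = ∑ i, ∑ j, ((c i : ℝ) * (c j : ℝ)) • Γ.gamma (f i) (f j) := by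
      simp only [map_sum, map_smul, LinearMap.sum_apply, LinearMap.smul_apply, Finset.smul_sum,
        smul_smul]
      rw [Finset.sum_comm]
      refine Finset.sum_congr rfl fun i _ => Finset.sum_congr rfl fun j _ => ?_
      rw [mul_comm]
    have h2 : ∀ᵐ x ∂μ, (∑ i, ∑ j, ((c i : ℝ) * (c j : ℝ)) • Γ.gamma (f i) (f j) : Lp ℝ 1 μ) x
        = ∑ i, ∑ j, (c i : ℝ) * (c j : ℝ) * Γ.gamma (f i) (f j) x := by
      have ha := Lp.coeFn_finsetSum (μ := μ) (p := 1) Finset.univ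
        (fun i => ∑ j, ((c i : ℝ) * (c j : ℝ)) • Γ.gamma (f i) (f j))
      have hb : ∀ᵐ x ∂μ, ∀ i, (∑ j, ((c i : ℝ) * (c j : ℝ)) • Γ.gamma (f i) (f j) : Lp ℝ 1 μ) x
          = ∑ j, (((c i : ℝ) * (c j : ℝ)) • Γ.gamma (f i) (f j) : Lp ℝ 1 μ) x := by
        rw [ae_all_iff]
        intro i
        filter_upwards [Lp.coeFn_finsetSum (μ := μ) (p := 1) Finset.univ
          (fun j => ((c i : ℝ) * (c j : ℝ)) • Γ.gamma (f i) (f j))] with x hx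
        simpa using hx
      have hc : ∀ᵐ x ∂μ, ∀ i j, (((c i : ℝ) * (c j : ℝ)) • Γ.gamma (f i) (f j) : Lp ℝ 1 μ) x
          = (c i : ℝ) * (c j : ℝ) * Γ.gamma (f i) (f j) x := by
        simp only [ae_all_iff]
        intro i j
        exact Lp.coeFn_smul _ _
      filter_upwards [ha, hb, hc] with x hxa hxb hxc
      rw [hxa]
      simp only [Finset.sum_apply, hxb, hxc]
    rw [h1] at h0
    filter_upwards [h0, h2] with x hx0 hx2
    rwa [← hx2]
  have hall : ∀ᵐ x ∂μ, ∀ c : Fin n → ℚ,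
      0 ≤ ∑ i, ∑ j, (c i : ℝ) * (c j : ℝ) * Γ.gamma (f i) (f j) x := ae_all_iff.2 hsum
  have hval : ∀ᵐ x ∂μ,
      Γ.fiberInner (∑ i, Γ.tmul (f i) (g i)) (∑ i, Γ.tmul (f i) (g i)) x
        = ∑ i, ∑ j, (g i).1 x * (g j).1 x * Γ.gamma (f i) (f j) x := by
    have h1 : Γ.fiberInner (∑ i, Γ.tmul (f i) (g i)) (∑ i, Γ.tmul (f i) (g i))
        = ∑ i, ∑ j, boundedMeasurable.mulL1 μ (Γ.gamma (f i) (f j)) (g i * g j) := by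
      simp only [map_sum, LinearMap.sum_apply, fiberInner_tmul]
      rw [Finset.sum_comm]
    have ha := Lp.coeFn_finsetSum (μ := μ) (p := 1) Finset.univ
      (fun i => ∑ j, boundedMeasurable.mulL1 μ (Γ.gamma (f i) (f j)) (g i * g j))
    have hb : ∀ᵐ x ∂μ, ∀ i,
        (∑ j, boundedMeasurable.mulL1 μ (Γ.gamma (f i) (f j)) (g i * g j) : Lp ℝ 1 μ) x
          = ∑ j, boundedMeasurable.mulL1 μ (Γ.gamma (f i) (f j)) (g i * g j) x := by
      rw [ae_all_iff]
      intro i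
      filter_upwards [Lp.coeFn_finsetSum (μ := μ) (p := 1) Finset.univ
        (fun j => boundedMeasurable.mulL1 μ (Γ.gamma (f i) (f j)) (g i * g j))] with x hx
      simpa using hx
    have hc : ∀ᵐ x ∂μ, ∀ i j, boundedMeasurable.mulL1 μ (Γ.gamma (f i) (f j)) (g i * g j) x
        = (g i).1 x * (g j).1 x * Γ.gamma (f i) (f j) x := by
      simp only [ae_all_iff]
      intro i j
      exact boundedMeasurable.mulL1_coe _ _
    rw [h1]
    filter_upwards [ha, hb, hc] with x hxa hxb hxc
    rw [hxa]
    simp only [Finset.sum_apply, hxb, hxc]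
  filter_upwards [hall, hval] with x hx hxv
  rw [hxv]
  -- rational coefficients are dense among real ones
  have hdense : DenseRange (fun (c : Fin n → ℚ) (i : Fin n) => ((c i : ℚ) : ℝ)) :=
    DenseRange.piMap (fun _ => Rat.denseRange_cast)
  have hclosed : IsClosed {r : Fin n → ℝ |
      0 ≤ ∑ i, ∑ j, r i * r j * Γ.gamma (f i) (f j) x} :=
    isClosed_le continuous_const (by fun_prop)
  exact hdense.induction_on
    (p := fun r => 0 ≤ ∑ i, ∑ j, r i * r j * Γ.gamma (f i) (f j) x) (fun i => (g i).1 x) hclosed hx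

/-- The scalar product on simple one-forms, the bilinear extension of
`⟪f₁ ⊗ g₁, f₂ ⊗ g₂⟫ = ∫ g₁ g₂ Γ(f₁,f₂) dμ`. -/
@[reducible] def simpleFormCore : PreInnerProductSpace.Core ℝ Γ.SimpleForm where
  inner ω η := ∫ x, Γ.fiberInner ω η x ∂μ
  conj_inner_symm ω η := by
    simp only [conj_trivial]
    rw [Γ.fiberInner_symm]
  re_inner_nonneg ω := integral_nonneg_of_ae (Γ.fiberInner_nonneg ω)
  add_left ω η θ := by
    rw [map_add, LinearMap.add_apply, ← integral_add (L1.integrable_coeFn _)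
      (L1.integrable_coeFn _)]
    exact integral_congr_ae (Lp.coeFn_add _ _)
  smul_left ω η r := by
    rw [map_smul, LinearMap.smul_apply, conj_trivial, ← integral_const_mul]
    exact integral_congr_ae (Lp.coeFn_smul _ _)

instance : SeminormedAddCommGroup Γ.SimpleForm :=
  @InnerProductSpace.Core.toSeminormedAddCommGroup ℝ _ _ _ _ Γ.simpleFormCore

instance : InnerProductSpace ℝ Γ.SimpleForm :=
  InnerProductSpace.ofCore Γ.simpleFormCore

/-- The Hilbert space `𝓗` of (square integrable) one-forms: the Hausdorff completion of the simple
one-forms. Since the simple one-forms `f ⊗ g` with `f` continuous and bounded are dense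
when the form is regular, it is the same space as the completion of those. -/
abbrev OneForm : Type u := UniformSpace.Completion Γ.SimpleForm

/-- The exterior derivative `∂ f = f ⊗ 1`, with domain `Dom ℰ`. -/
def exteriorDeriv (f : E.domain) : Γ.OneForm :=
  ((Γ.tmul f 1 : Γ.SimpleForm) : UniformSpace.Completion Γ.SimpleForm)

/-- `η ∈ Dom ∂*` and `∂* η = g`, i.e. `⟪η, ∂φ⟫ = ⟪g, φ⟫` for all `φ ∈ Dom ℰ`. -/
def IsCodifferential (η : Γ.OneForm) (g : Lp ℝ 2 μ) : Prop :=
  ∀ φ : E.domain, inner ℝ η (Γ.exteriorDeriv φ) = inner ℝ g (φ : Lp ℝ 2 μ)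

/-- The squared fibre norm `x ↦ ‖η‖²_{𝓗_x}` of a one-form, as an element of `L¹(μ)`: the continuous
extension to `𝓗` of `ω ↦ ⟪ω, ω⟫_x`. -/
def fiberNormSq (η : Γ.OneForm) : Lp ℝ 1 μ :=
  (UniformSpace.Completion.isDenseInducing_coe (α := Γ.SimpleForm)).extend
    (fun ω => Γ.fiberInner ω ω) η

/-- The fibre norm `‖η‖_{𝓗_x}`. -/
def fiberNorm (η : Γ.OneForm) (x : X) : ℝ := Real.sqrt (Γ.fiberNormSq η x)

/-! ### Variation, perimeter, isoperimetric constant -/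

/-- `Var f = sup {⟪f, ∂* η⟫ | η ∈ Dom ∂*, ‖η‖_{𝓗_x} ≤ 1 for μ-almost every x}`. -/
def variation (f : Lp ℝ 2 μ) : ℝ≥0∞ :=
  ⨆ (η : Γ.OneForm) (g : Lp ℝ 2 μ) (_ : Γ.IsCodifferential η g)
    (_ : ∀ᵐ x ∂μ, Γ.fiberNorm η x ≤ 1), ENNReal.ofReal (inner ℝ f g)

/-- The perimeter `P(A) = Var 1_A` of a measurable set. -/
def perimeter [IsFiniteMeasure μ] {A : Set X} (hA : MeasurableSet A) : ℝ≥0∞ :=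
  Γ.variation (indicatorConstLp 2 hA (measure_ne_top μ A) (1 : ℝ))

/-- The Gaussian isoperimetric constant `k`, the infimum of `P(A) / (μ(A) √(-ln μ(A)))` over the
sets `A` of finite perimeter with `0 < μ(A) ≤ 1/2`. -/
def gaussianIsoperimetricConstant [IsFiniteMeasure μ] : ℝ≥0∞ :=
  ⨅ (A : Set X) (hA : MeasurableSet A) (_ : Γ.perimeter hA < ∞) (_ : 0 < μ A)
    (_ : μ A ≤ 1 / 2),
    Γ.perimeter hA / (μ A * ENNReal.ofReal (Real.sqrt (-Real.log (μ A).toReal)))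

/-! ### The log-Sobolev inequality and the weak Bakry–Émery estimate -/

/-- The log-Sobolev inequality
`∫ f² ln f² dμ - ∫ f² dμ ln ∫ f² dμ ≤ ρ⁻¹ ∫ Γ(f) dμ` for all `f ∈ Dom ℰ` (in particular, the
left-hand side is finite). -/
def LogSobolev (ρ : ℝ) : Prop :=
  ∀ f : E.domain,
    Integrable (fun x => ((f : Lp ℝ 2 μ) x) ^ 2 * Real.log (((f : Lp ℝ 2 μ) x) ^ 2)) μ ∧
    (∫ x, ((f : Lp ℝ 2 μ) x) ^ 2 * Real.log (((f : Lp ℝ 2 μ) x) ^ 2) ∂μ)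
        - (∫ x, ((f : Lp ℝ 2 μ) x) ^ 2 ∂μ) * Real.log (∫ x, ((f : Lp ℝ 2 μ) x) ^ 2 ∂μ)
      ≤ (1 / ρ) * ∫ x, Γ.gamma f f x ∂μ

/-- The log-Sobolev constant: the supremum of the `ρ > 0` for which the log-Sobolev inequality
holds. -/
def logSobolevConstant : ℝ≥0∞ :=
  ⨆ (ρ : ℝ) (_ : 0 < ρ) (_ : Γ.LogSobolev ρ), ENNReal.ofReal ρ

theorem memLp_sqrt_gamma (f : E.domain) :
    MemLp (fun x => Real.sqrt (Γ.gamma f f x)) 2 μ := by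
  have hm : AEStronglyMeasurable (fun x => Real.sqrt (Γ.gamma f f x)) μ :=
    Real.continuous_sqrt.comp_aestronglyMeasurable (Lp.aestronglyMeasurable _)
  rw [memLp_two_iff_integrable_sq hm]
  refine (L1.integrable_coeFn (Γ.gamma f f)).congr ?_
  filter_upwards [Γ.nonneg f] with x hx
  exact (Real.sq_sqrt hx).symm

/-- `√Γ(f)`, as an element of `L²(μ)`. -/
def sqrtGamma (f : E.domain) : Lp ℝ 2 μ := (Γ.memLp_sqrt_gamma f).toLp _

/-- The weak Bakry–Émery estimate `√Γ(P_t f) ≤ C₁ e^{C₂ t} P_t √Γ(f)`, `μ`-almost everywhere, for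
all `f ∈ Dom ℰ` and `t ≥ 0`. -/
def WeakBakryEmery (C₁ C₂ : ℝ) : Prop :=
  ∀ (t : ℝ), 0 ≤ t → ∀ f u : E.domain, (u : Lp ℝ 2 μ) = E.heat t (f : Lp ℝ 2 μ) →
    ∀ᵐ x ∂μ, Γ.sqrtGamma u x
      ≤ C₁ * Real.exp (C₂ * t) * E.heat t (Γ.sqrtGamma f) x

end CarreDuChamp

end

/-! ### Hille–Yosida approximation -/

section HilleYosida

variable {H : Type*} [NormedAddCommGroup H] [NormedSpace ℝ H] [CompleteSpace H]

/-! This is Ledoux's argument, run with the normalized resolvents J_α = α(α - Δ)⁻¹ in place of the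
heat semigroup. Let f be the indicator of a set A with m = μ(A) ≤ 1/2. The defect m - ⟪f, J_α f⟫ is
bounded above by the perimeter and below by means of the log-Sobolev inequality.

Upper bound. J_α is the average of P_t over an exponentially distributed time, so the weak
Bakry–Émery estimate passes to J_α by Jensen (`WeakBakryEmery.inner_sqrtGamma_approx_le`). Combined
with the identity defining Γ it shows that w = J_α J_{4α} f satisfies √Γ(w) ≤ 2C₁√α
(`WeakBakryEmery.sqrtGamma_approx_approx_le`). Hence ∂w/(2C₁√α) is a competitor in the definition of
Var f, and ∂*∂w = α(J_{4α} f - w). This bounds ⟪f, J_{4α} f - J_α f⟫ by a multiple of P(A)/√α.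
Summing over α, 4α, 16α, … is a geometric series of ratio 1/2, and m - ⟪f, J_α f⟫ ≤ 4C₁P(A)/√α
(`WeakBakryEmery.inner_self_sub_le`).

Lower bound. One application of log-Sobolev to u = J_α f takes the place of hypercontractivity.
Since ∫u ≤ m, a large F = ‖u‖² forces a large entropy, while the energy of u is at most α(m - F)
(`LogSobolev.norm_sq_approx_mul_log_le`). For α = ρ log(1/m) this gives F ≤ 3m/4, whence ⟪f, u⟫ ≤
7m/8.

Together, m/8 ≤ 4C₁P(A)/√α, that is √ρ m √(log(1/m)) ≤ 32C₁P(A). The remaining work is foundational: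
the semigroup on L² and on Dom ℰ with its Laplace transform, the algebra of bounded functions in Dom
ℰ, and ∫Γ(f,g) = ℰ(f,g), which follows from strict locality. -/

open NormedSpace in
theorem exp_add_of_commute_clm {A B : H →L[ℝ] H} (h : Commute A B) :
    exp (A + B) = exp A * exp B :=
  letI : NormedAlgebra ℚ (H →L[ℝ] H) := .restrictScalars ℚ ℝ _
  exp_add_of_commute h

-- Because e^{s(J-1)} = e^{-s}e^{sJ}, and the power series bounds the second factor by e^s when J is
-- a contraction. With J = J_α this makes the Yosida exponentials contractions.
open NormedSpace in
theorem norm_exp_smul_sub_one_apply_le {J : H →L[ℝ] H} (hJ : ‖J‖ ≤ 1) {s : ℝ} (hs : 0 ≤ s)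
    (x : H) : ‖exp (s • (J - 1)) x‖ ≤ ‖x‖ := by
  have h1 : exp (s • (J - 1)) = Real.exp (-s) • exp (s • J) := by
    have : s • (J - 1) = algebraMap ℝ (H →L[ℝ] H) (-s) + s • J := by
      rw [Algebra.algebraMap_eq_smul_one, smul_sub, neg_smul]; abel
    rw [this, exp_add_of_commute_clm (Algebra.commutes (-s) (s • J)), ← algebraMap_exp_comm (-s),
      ← Algebra.smul_def, Real.exp_eq_exp_ℝ]
  have h2 : ‖exp (s • J)  x‖ ≤ Real.exp s * ‖x‖ := by
    have hsum : HasSum (fun n : ℕ => ((n.factorial : ℝ)⁻¹ • (s • J) ^ n) x) (exp (s • J) x) :=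
      (NormedSpace.exp_series_hasSum_exp' (𝕂 := ℝ) (s • J)).mapL
        (ContinuousLinearMap.apply ℝ H x)
    have hreal : HasSum (fun n : ℕ => (n.factorial : ℝ)⁻¹ • s ^ n) (Real.exp s) := by
      rw [Real.exp_eq_exp_ℝ]
      exact NormedSpace.exp_series_hasSum_exp' (𝕂 := ℝ) s
    refine hsum.norm_le_of_bounded (hreal.mul_right ‖x‖) fun n => ?_
    have hpow : ∀ n : ℕ, ‖(J ^ n) x‖ ≤ ‖x‖ := by
      intro n
      induction n with
      | zero => simp
      | succ k ih =>
        rw [pow_succ']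
        exact (J.le_of_opNorm_le hJ _).trans (by rwa [one_mul])
    rw [smul_pow, smul_apply, smul_apply, norm_smul,
      norm_smul, smul_eq_mul, Real.norm_of_nonneg (by positivity),
      Real.norm_of_nonneg (by positivity),
      ← mul_assoc]
    gcongr
    exact hpow n
  rw [h1, smul_apply, norm_smul, Real.norm_of_nonneg (Real.exp_pos _).le]
  calc _ ≤ Real.exp (-s) * (Real.exp s * ‖x‖) := by gcongr
    _ = ‖x‖ := by rw [← mul_assoc, ← Real.exp_add]; simp

-- The path s ↦ e^{sA}e^{(t-s)B}x joins the two vectors, and its derivative e^{sA}e^{(t-s)B}(A - B)x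
-- has norm at most ‖(A - B)x‖. No operator norm of A or B enters, so the bound survives along
-- Yosida approximations of an unbounded generator.
open NormedSpace in
theorem norm_exp_smul_apply_sub_le {A B : H →L[ℝ] H} (hAB : Commute A B)
    (hA : ∀ s : ℝ, 0 ≤ s → ∀ x, ‖exp (s • A) x‖ ≤ ‖x‖)
    (hB : ∀ s : ℝ, 0 ≤ s → ∀ x, ‖exp (s • B) x‖ ≤ ‖x‖) {t : ℝ} (ht : 0 ≤ t) (x : H) :
    ‖exp (t • A) x - exp (t • B) x‖ ≤ t * ‖A x - B x‖ := by
  -- The path is written as e^{s(A-B)}e^{tB}x, so that only one factor depends on s; the contractive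
  -- form is recovered from `hsplit`.
  have hder : ∀ s : ℝ, HasDerivAt (fun s : ℝ => exp (s • (A - B)) (exp (t • B) x))
      (exp (s • (A - B)) ((A - B) (exp (t • B) x))) s := fun s =>
    ((ContinuousLinearMap.apply ℝ H (exp (t • B) x)).hasFDerivAt.comp_hasDerivAt s
      (hasDerivAt_exp_smul_const (A - B) s) :)
  have hsplit : ∀ s : ℝ, exp (s • (A - B)) * exp (t • B) = exp (s • A) * exp ((t - s) • B) := by
    intro s
    rw [← exp_add_of_commute_clm, ← exp_add_of_commute_clm]
    · congr 1
      rw [smul_sub, sub_smul]; abel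
    · exact (hAB.smul_left s).smul_right _
    · exact ((hAB.sub_left (Commute.refl B)).smul_left s).smul_right t
  have hcomm : (A - B) * exp (t • B) = exp (t • B) * (A - B) :=
    ((hAB.sub_left (Commute.refl B)).smul_right t).exp_right.eq
  have hb : ∀ s ∈ Set.Ico (0 : ℝ) t,
      ‖exp (s • (A - B)) ((A - B) (exp (t • B) x))‖ ≤ ‖A x - B x‖ := by
    intro s hs
    have h1 : exp (s • (A - B)) ((A - B) (exp (t • B) x))
        = exp (s • A) (exp ((t - s) • B) (A x - B x)) := by
      have h2 : exp (s • (A - B)) * ((A - B) * exp (t • B))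
          = exp (s • A) * exp ((t - s) • B) * (A - B) := by
        rw [hcomm, ← mul_assoc, hsplit]
      exact congrArg (fun T : H →L[ℝ] H => T x) h2
    rw [h1]
    exact (hA s hs.1 _).trans (hB _ (sub_nonneg.2 hs.2.le) _)
  have := norm_image_sub_le_of_norm_deriv_le_segment' (a := 0) (b := t)
    (fun s _ => (hder s).hasDerivWithinAt) hb t ⟨ht, le_rfl⟩
  have h0 : exp (t • (A - B)) (exp (t • B) x) = exp (t • A) x := by
    have h2 := congrArg (fun T : H →L[ℝ] H => T x) (hsplit t)
    simpa using h2
  rw [h0] at this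
  simpa [mul_comm] using this

open NormedSpace in
/-- Convergence of the exponentials of the Yosida approximations. -/
theorem exists_tendsto_exp_smul {A : ℕ → H →L[ℝ] H} (hcomm : ∀ m n, Commute (A m) (A n))
    (hA : ∀ n, ∀ s : ℝ, 0 ≤ s → ∀ x, ‖exp (s • A n) x‖ ≤ ‖x‖) {D : Set H} (hD : Dense D)
    (hconv : ∀ x ∈ D, CauchySeq fun n => A n x) {t : ℝ} (ht : 0 ≤ t) (x : H) :
    ∃ y, Tendsto (fun n => exp (t • A n) x) atTop (𝓝 y) := by
  apply cauchySeq_tendsto_of_complete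
  rw [Metric.cauchySeq_iff']
  intro ε hε
  obtain ⟨z, hz, hxz⟩ := hD.exists_dist_lt x (show (0 : ℝ) < ε / 4 by positivity)
  -- The shift to t + 1 keeps the denominator positive when t = 0.
  obtain ⟨N, hN⟩ := Metric.cauchySeq_iff'.1 (hconv z hz) (ε / (4 * (t + 1))) (by positivity)
  refine ⟨N, fun n hn => ?_⟩
  have h1 := norm_exp_smul_apply_sub_le (hcomm n N) (hA n) (hA N) ht z
  have h2 : t * ‖A n z - A N z‖ ≤ ε / 4 := by
    have h3 := (hN n hn).le
    rw [dist_eq_norm] at h3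
    calc t * ‖A n z - A N z‖ ≤ (t + 1) * (ε / (4 * (t + 1))) := by gcongr; linarith
      _ = ε / 4 := by field_simp
  have h4 := hA n t ht (x - z)
  have h5 := hA N t ht (z - x)
  rw [dist_eq_norm] at hxz ⊢
  have h6 : exp (t • A n) x - exp (t • A N) x = exp (t • A n) (x - z)
      + (exp (t • A n) z - exp (t • A N) z) + exp (t • A N) (z - x) := by
    simp only [map_sub]; abel
  rw [norm_sub_rev z x] at h5
  rw [h6]
  calc _ ≤ _ := norm_add₃_le
    _ < ε := by linarith

-- The integrand is the derivative of -e^{-αt}e^{tA}y, which vanishes at infinity by contractivity.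
open NormedSpace in
theorem integral_exp_smul_apply {A : H →L[ℝ] H}
    (hA : ∀ s : ℝ, 0 ≤ s → ∀ x, ‖exp (s • A) x‖ ≤ ‖x‖) {α : ℝ} (hα : 0 < α) (y : H) :
    ∫ t in Set.Ioi (0 : ℝ), Real.exp (-α * t) • exp (t • A) (α • y - A y) = y := by
  have hder : ∀ t : ℝ, HasDerivAt (fun t : ℝ => -(Real.exp (-α * t) • exp (t • A) y))
      (Real.exp (-α * t) • exp (t • A) (α • y - A y)) t := by
    intro t
    have h1 : HasDerivAt (fun t : ℝ => exp (t • A) y) (exp (t • A) (A y)) t :=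
      ((ContinuousLinearMap.apply ℝ H y).hasFDerivAt.comp_hasDerivAt t
        (hasDerivAt_exp_smul_const A t) :)
    have h2 : HasDerivAt (fun t : ℝ => Real.exp (-α * t)) (Real.exp (-α * t) * (-α)) t := by
      simpa using ((hasDerivAt_id t).const_mul (-α)).exp
    refine ((h2.smul h1).neg).congr_deriv ?_
    rw [map_sub, map_smul, smul_sub, neg_add, mul_smul, neg_smul, smul_neg, neg_neg]
    abel
  have hcont : ∀ z : H, Continuous fun t : ℝ => Real.exp (-α * t) • exp (t • A) z := by
    intro z
    have : Continuous fun t : ℝ => exp (t • A) :=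
      continuous_iff_continuousAt.2 fun t => (hasDerivAt_exp_smul_const A t).continuousAt
    exact (by fun_prop : Continuous fun t : ℝ => Real.exp (-α * t)).smul
      (this.clm_apply continuous_const)
  have hint : IntegrableOn (fun t : ℝ => Real.exp (-α * t) • exp (t • A) (α • y - A y))
      (Set.Ioi 0) := by
    refine Integrable.mono' ((integrableOn_exp_mul_Ioi (neg_lt_zero.2 hα) 0).mul_const
      ‖α • y - A y‖) (hcont _).aestronglyMeasurable ?_
    refine (ae_restrict_iff' measurableSet_Ioi).2 (Eventually.of_forall fun t ht => ?_)
    rw [norm_smul, Real.norm_of_nonneg (Real.exp_pos _).le]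
    gcongr
    exact hA t (le_of_lt ht) _
  have hlim : Tendsto (fun t : ℝ => -(Real.exp (-α * t) • exp (t • A) y)) atTop (𝓝 0) := by
    rw [← neg_zero]
    refine Tendsto.neg (squeeze_zero_norm' (a := fun t => Real.exp (-α * t) * ‖y‖) ?_ ?_)
    · filter_upwards [eventually_ge_atTop 0] with t ht
      rw [norm_smul, Real.norm_of_nonneg (Real.exp_pos _).le]
      gcongr
      exact hA t ht _
    · have : Tendsto (fun t : ℝ => Real.exp (-α * t)) atTop (𝓝 0) := by
        apply Real.tendsto_exp_atBot.comp
        exact tendsto_id.const_mul_atTop_of_neg (neg_lt_zero.2 hα)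
      simpa using this.mul_const ‖y‖
  rw [integral_Ioi_of_hasDerivAt_of_tendsto (hder 0).continuousAt.continuousWithinAt
    (fun t _ => hder t) hint hlim]
  simp

open NormedSpace in
/-- The Laplace transform of the semigroup generated by the limit of `A n`. -/
theorem integral_exp_smul_of_tendsto {A : ℕ → H →L[ℝ] H}
    (hA : ∀ n, ∀ s : ℝ, 0 ≤ s → ∀ x, ‖exp (s • A n) x‖ ≤ ‖x‖) {P : ℝ → H → H}
    (hP : ∀ t : ℝ, 0 ≤ t → ∀ x, Tendsto (fun n => exp (t • A n) x) atTop (𝓝 (P t x)))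
    {α : ℝ} (hα : 0 < α) {x y : H} (hy : Tendsto (fun n => A n y) atTop (𝓝 (α • y - x))) :
    ∫ t in Set.Ioi (0 : ℝ), Real.exp (-α * t) • P t x = y := by
  -- With x replaced by αy - A_n y the identity is exact for every n, so only dominated convergence
  -- is left.
  have hx : Tendsto (fun n => α • y - A n y) atTop (𝓝 x) := by
    simpa using hy.const_sub (α • y)
  obtain ⟨M, hM⟩ := hx.norm.bddAbove_range
  have hM' : ∀ n, ‖α • y - A n y‖ ≤ M := fun n => hM ⟨n, rfl⟩
  have hlim := tendsto_integral_of_dominated_convergence (μ := volume.restrict (Set.Ioi (0 : ℝ)))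
    (F := fun n t => Real.exp (-α * t) • exp (t • A n) (α • y - A n y))
    (f := fun t => Real.exp (-α * t) • P t x)
    (fun t => Real.exp (-α * t) * M) ?_ ?_ ?_ ?_
  · simp only [integral_exp_smul_apply (hA _) hα y] at hlim
    exact tendsto_nhds_unique hlim tendsto_const_nhds
  · intro n
    have : Continuous fun t : ℝ => exp (t • A n) :=
      continuous_iff_continuousAt.2 fun t => (hasDerivAt_exp_smul_const (A n) t).continuousAt
    exact ((by fun_prop : Continuous fun t : ℝ => Real.exp (-α * t)).smul
      (this.clm_apply continuous_const)).aestronglyMeasurable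
  · exact (integrableOn_exp_mul_Ioi (neg_lt_zero.2 hα) 0).mul_const M
  · intro n
    refine (ae_restrict_iff' measurableSet_Ioi).2 (Eventually.of_forall fun t ht => ?_)
    rw [norm_smul, Real.norm_of_nonneg (Real.exp_pos _).le]
    gcongr
    exact (hA n t (le_of_lt ht) _).trans (hM' n)
  · refine (ae_restrict_iff' measurableSet_Ioi).2 (Eventually.of_forall fun t ht => ?_)
    refine Tendsto.const_smul ?_ _
    have h1 : Tendsto (fun n => exp (t • A n) (α • y - A n y - x)) atTop (𝓝 0) := by
      refine squeeze_zero_norm (fun n => hA n t (le_of_lt ht) _) ?_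
      simpa using (hx.sub_const x).norm
    have h2 := h1.add (hP t (le_of_lt ht) x)
    simpa [map_sub] using h2

end HilleYosida

section ResolventFamily

variable {H : Type*} [NormedAddCommGroup H] [NormedSpace ℝ H]

theorem tendsto_apply_of_dense {T : ℕ → H →L[ℝ] H} (hT : ∀ n x, ‖T n x‖ ≤ ‖x‖) {D : Set H}
    (hD : Dense D) (h : ∀ x ∈ D, Tendsto (fun n => T n x) atTop (𝓝 x)) (x : H) :
    Tendsto (fun n => T n x) atTop (𝓝 x) := by
  rw [Metric.tendsto_atTop]
  intro ε hε
  obtain ⟨z, hz, hxz⟩ := hD.exists_dist_lt x (show (0 : ℝ) < ε / 3 by positivity)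
  obtain ⟨N, hN⟩ := Metric.tendsto_atTop.1 (h z hz) (ε / 3) (by positivity)
  refine ⟨N, fun n hn => ?_⟩
  have h1 := hN n hn
  have h2 := hT n (x - z)
  rw [dist_eq_norm] at hxz h1 ⊢
  have h3 : T n x - x = T n (x - z) + (T n z - z) + (z - x) := by
    rw [map_sub]; abel
  rw [h3]
  rw [norm_sub_rev] at hxz
  rw [norm_sub_rev x z] at h2
  calc _ ≤ _ := norm_add₃_le
    _ < ε := by linarith

end ResolventFamily

namespace DirichletForm

variable {X : Type u} [MeasurableSpace X] {μ : Measure X} (E : DirichletForm μ)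

/-! ### The operators `α (α - Δ)⁻¹` -/

/-- The normalized resolvent `α (α - Δ)⁻¹`, with values in `Dom ℰ`. -/
noncomputable def approx (α : Set.Ioi (0 : ℝ)) : Lp ℝ 2 μ →ₗ[ℝ] E.domain :=
  FormSpace.out E α ∘ₗ (α.1 • (ContinuousLinearMap.adjoint (E.formInclusion α)).toLinearMap)

theorem coe_approx (α : Set.Ioi (0 : ℝ)) (f : Lp ℝ 2 μ) :
    (E.approx α f : Lp ℝ 2 μ) = α.1 • E.resolvent α f := rfl

/-- The weak form of -Δ J_α f = α(f - J_α f); it stands in for the generator everywhere below. -/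
theorem form_approx (α : Set.Ioi (0 : ℝ)) (f : Lp ℝ 2 μ) (v : E.domain) :
    E.form (E.approx α f) v
      = α.1 * inner ℝ (f - (E.approx α f : Lp ℝ 2 μ)) (v : Lp ℝ 2 μ) := by
  obtain ⟨u, hu, h⟩ := E.resolvent_spec α f
  have h1 : E.approx α f = α.1 • u := Subtype.ext (by rw [coe_approx, ← hu]; rfl)
  have h2 := h v
  rw [h1, map_smul, LinearMap.smul_apply, smul_eq_mul, Submodule.coe_smul, inner_sub_left,
    real_inner_smul_left]
  rw [← h2]; ring

theorem add_sq_form_nonneg_eq_zero {α : ℝ} (hα : 0 < α) {d : E.domain}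
    (h : α * ‖(d : Lp ℝ 2 μ)‖ ^ 2 + E.form d d ≤ 0) : d = 0 := by
  have h1 := E.nonneg d
  have h2 : ‖(d : Lp ℝ 2 μ)‖ ^ 2 ≤ 0 := by
    by_contra hc
    have := mul_pos hα (not_le.1 hc)
    linarith
  have h3 : ‖(d : Lp ℝ 2 μ)‖ = 0 := by
    have := sq_nonneg ‖(d : Lp ℝ 2 μ)‖
    exact pow_eq_zero_iff (two_ne_zero) |>.1 (le_antisymm h2 this)
  exact Subtype.ext (norm_eq_zero.1 h3)

/-- Two solutions differ by some d with α‖d‖² + ℰ(d,d) = 0. -/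
theorem eq_approx {α : Set.Ioi (0 : ℝ)} {f : Lp ℝ 2 μ} {u : E.domain}
    (h : ∀ v : E.domain, E.form u v = α.1 * inner ℝ (f - (u : Lp ℝ 2 μ)) (v : Lp ℝ 2 μ)) :
    u = E.approx α f := by
  rw [← sub_eq_zero]
  refine E.add_sq_form_nonneg_eq_zero (α := α.1) α.2 (le_of_eq ?_)
  rw [map_sub E.form, LinearMap.sub_apply, h, E.form_approx, ← real_inner_self_eq_norm_sq,
    ← mul_sub, ← inner_sub_left, ← mul_add, ← inner_add_left, Submodule.coe_sub]
  simp

theorem form_sub_self (u v : E.domain) :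
    E.form (u - v) (u - v) = E.form u u - 2 * E.form u v + E.form v v := by
  simp only [map_sub, LinearMap.sub_apply, E.symm v u]; ring

theorem form_sq_le (u v : E.domain) : E.form u v ^ 2 ≤ E.form u u * E.form v v := by
  have h : ∀ x : ℝ, 0 ≤ E.form u u * (x * x) + (-2 * E.form u v) * x + E.form v v := by
    intro x
    have := E.nonneg (x • u - v)
    rw [form_sub_self] at this
    simp only [map_smul, LinearMap.smul_apply, smul_eq_mul] at this
    linarith
  have := discrim_le_zero h
  rw [discrim] at this
  nlinarith

theorem norm_approx_le (α : Set.Ioi (0 : ℝ)) (f : Lp ℝ 2 μ) :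
    ‖(E.approx α f : Lp ℝ 2 μ)‖ ≤ ‖f‖ := by
  have h1 := E.nonneg (E.approx α f)
  rw [form_approx, inner_sub_left, real_inner_self_eq_norm_sq] at h1
  have h2 := real_inner_le_norm f (E.approx α f : Lp ℝ 2 μ)
  have h3 := nonneg_of_mul_nonneg_right h1 (Set.mem_Ioi.1 α.2)
  by_contra hc
  push Not at hc
  have := norm_nonneg f
  nlinarith

theorem form_approx_sub (α : Set.Ioi (0 : ℝ)) (u : E.domain) :
    E.form (E.approx α (u : Lp ℝ 2 μ)) (u - E.approx α (u : Lp ℝ 2 μ))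
      = α.1 * ‖(u : Lp ℝ 2 μ) - (E.approx α (u : Lp ℝ 2 μ) : Lp ℝ 2 μ)‖ ^ 2 := by
  rw [form_approx, Submodule.coe_sub, real_inner_self_eq_norm_sq]

/-- By `form_approx_sub`, ℰ(J_α u, J_α u) ≤ ℰ(J_α u, u); insert this in ℰ(u - J_α u, u - J_α u) ≥ 0.
-/
theorem form_approx_le (α : Set.Ioi (0 : ℝ)) (u : E.domain) :
    E.form (E.approx α (u : Lp ℝ 2 μ)) (E.approx α (u : Lp ℝ 2 μ)) ≤ E.form u u := by
  have h1 := E.form_approx_sub α u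
  have h2 : 0 ≤ α.1 * ‖(u : Lp ℝ 2 μ) - (E.approx α (u : Lp ℝ 2 μ) : Lp ℝ 2 μ)‖ ^ 2 :=
    mul_nonneg (le_of_lt α.2) (sq_nonneg _)
  have h3 := E.nonneg (u - E.approx α (u : Lp ℝ 2 μ))
  rw [← h1] at h2
  simp only [map_sub, LinearMap.sub_apply] at h2 h3
  rw [E.symm u (E.approx α (u : Lp ℝ 2 μ))] at h3
  linarith

theorem norm_sub_approx_sq_le (α : Set.Ioi (0 : ℝ)) (u : E.domain) :
    ‖(u : Lp ℝ 2 μ) - (E.approx α (u : Lp ℝ 2 μ) : Lp ℝ 2 μ)‖ ^ 2 ≤ E.form u u / α.1 := by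
  rw [le_div_iff₀ (Set.mem_Ioi.1 α.2), mul_comm, ← form_approx_sub]
  have h3 := E.nonneg (u - E.approx α (u : Lp ℝ 2 μ))
  have h4 := E.nonneg (E.approx α (u : Lp ℝ 2 μ))
  simp only [map_sub, LinearMap.sub_apply] at h3 ⊢
  rw [E.symm u (E.approx α (u : Lp ℝ 2 μ))] at h3
  have h5 := E.form_approx_le α u
  linarith

theorem inner_approx_comm (α : Set.Ioi (0 : ℝ)) (f g : Lp ℝ 2 μ) :
    inner ℝ (E.approx α f : Lp ℝ 2 μ) g = inner ℝ f (E.approx α g : Lp ℝ 2 μ) := by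
  have h1 := E.form_approx α f (E.approx α g)
  have h2 := E.form_approx α g (E.approx α f)
  rw [E.symm, h2] at h1
  have h3 := mul_left_cancel₀ (ne_of_gt (Set.mem_Ioi.1 α.2)) h1
  rw [inner_sub_left, inner_sub_left, real_inner_comm (E.approx α f : Lp ℝ 2 μ) g,
    real_inner_comm (E.approx α f : Lp ℝ 2 μ) (E.approx α g : Lp ℝ 2 μ)] at h3
  linarith

/-- The resolvent identity. -/
theorem approx_eq (α β : Set.Ioi (0 : ℝ)) (f : Lp ℝ 2 μ) :
    E.approx α f = (α.1 / β.1) • E.approx β f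
      + (1 - α.1 / β.1) • E.approx α (E.approx β f : Lp ℝ 2 μ) := by
  have hβ : β.1 ≠ 0 := ne_of_gt (Set.mem_Ioi.1 β.2)
  refine (E.eq_approx fun v => ?_).symm
  rw [map_add, map_smul, map_smul, LinearMap.add_apply, LinearMap.smul_apply, LinearMap.smul_apply,
    form_approx, form_approx, Submodule.coe_add, Submodule.coe_smul, Submodule.coe_smul]
  simp only [inner_sub_left, inner_add_left, real_inner_smul_left, smul_eq_mul]
  field_simp
  ring

theorem approx_comm (α β : Set.Ioi (0 : ℝ)) (f : Lp ℝ 2 μ) :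
    E.approx α (E.approx β f : Lp ℝ 2 μ) = E.approx β (E.approx α f : Lp ℝ 2 μ) := by
  rcases eq_or_ne α β with rfl | hne
  · rfl
  have hβ : β.1 ≠ 0 := ne_of_gt (Set.mem_Ioi.1 β.2)
  have hα : α.1 ≠ 0 := ne_of_gt (Set.mem_Ioi.1 α.2)
  have hs : β.1 - α.1 ≠ 0 := fun h => hne (Subtype.ext (by linarith))
  have h1 := congrArg (β.1 • ·) (E.approx_eq α β f)
  have h2 := congrArg (α.1 • ·) (E.approx_eq β α f)
  simp only [smul_add, smul_smul] at h1 h2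
  rw [mul_div_cancel₀ _ hβ, mul_sub, mul_one, mul_div_cancel₀ _ hβ] at h1
  rw [mul_div_cancel₀ _ hα, mul_sub, mul_one, mul_div_cancel₀ _ hα] at h2
  rw [h1] at h2
  have h3 : (β.1 - α.1) • (E.approx α (E.approx β f : Lp ℝ 2 μ)
      - E.approx β (E.approx α f : Lp ℝ 2 μ)) = 0 := by
    have h4 : (β.1 - α.1) • E.approx α (E.approx β f : Lp ℝ 2 μ)
        = -((α.1 - β.1) • E.approx β (E.approx α f : Lp ℝ 2 μ)) := by
      rw [eq_neg_iff_add_eq_zero]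
      rwa [add_assoc, left_eq_add] at h2
    rw [smul_sub, h4, ← neg_smul, neg_sub, sub_self]
  exact sub_eq_zero.1 ((smul_eq_zero.1 h3).resolve_left hs)

/-- Both sides are Δ J_β J_α f. -/
theorem smul_approx_sub (α β : Set.Ioi (0 : ℝ)) (f : Lp ℝ 2 μ) :
    β.1 • (E.approx β (E.approx α f : Lp ℝ 2 μ) - E.approx α f)
      = α.1 • (E.approx β (E.approx α f : Lp ℝ 2 μ) - E.approx β f) := by
  have hβ : β.1 ≠ 0 := ne_of_gt (Set.mem_Ioi.1 β.2)
  have h1 := congrArg (β.1 • ·) (E.approx_eq α β f)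
  simp only [smul_add, smul_smul] at h1
  rw [mul_div_cancel₀ _ hβ, mul_sub, mul_one, mul_div_cancel₀ _ hβ, approx_comm] at h1
  rw [smul_sub, smul_sub, h1, sub_smul]
  abel

/-- `α (α - Δ)⁻¹` as a bounded operator on `L²`. -/
noncomputable def approxL (α : Set.Ioi (0 : ℝ)) : Lp ℝ 2 μ →L[ℝ] Lp ℝ 2 μ := α.1 • E.resolvent α

theorem norm_approxL_apply_le (α : Set.Ioi (0 : ℝ)) (f : Lp ℝ 2 μ) : ‖E.approxL α f‖ ≤ ‖f‖ :=
  E.norm_approx_le α f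

theorem approxL_apply (α : Set.Ioi (0 : ℝ)) (f : Lp ℝ 2 μ) :
    E.approxL α f = (E.approx α f : Lp ℝ 2 μ) := rfl

/-! ### Dom ℰ as a Hilbert space, and strong convergence of J_α in L² and in Dom ℰ -/

/-- `α = 1`. -/
def unitParam : Set.Ioi (0 : ℝ) := ⟨1, Set.mem_Ioi.2 one_pos⟩

/-- `Dom ℰ` with the norm `(‖u‖² + ℰ(u,u))^{1/2}`. -/
def DomSpace : Type u := E.FormSpace unitParam

noncomputable instance : NormedAddCommGroup E.DomSpace :=
  inferInstanceAs (NormedAddCommGroup (E.FormSpace unitParam))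

noncomputable instance : InnerProductSpace ℝ E.DomSpace :=
  inferInstanceAs (InnerProductSpace ℝ (E.FormSpace unitParam))

instance : CompleteSpace E.DomSpace :=
  inferInstanceAs (CompleteSpace (E.FormSpace unitParam))

/-- The identity map to `DomSpace`. -/
def toDom : E.domain →ₗ[ℝ] E.DomSpace where
  toFun u := u
  map_add' _ _ := rfl
  map_smul' _ _ := rfl

/-- The identity map from `DomSpace`. -/
def ofDom : E.DomSpace →ₗ[ℝ] E.domain where
  toFun u := u
  map_add' _ _ := rfl
  map_smul' _ _ := rfl

theorem toDom_ofDom (u : E.DomSpace) : E.toDom (E.ofDom u) = u := rfl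

theorem inner_toDom (u v : E.domain) :
    inner ℝ (E.toDom u) (E.toDom v) = inner ℝ (u : Lp ℝ 2 μ) (v : Lp ℝ 2 μ) + E.form u v := by
  have h := FormSpace.inner_def E unitParam (E.toDom u) (E.toDom v)
  simp only [unitParam, one_mul] at h
  exact h

theorem norm_toDom_sq (u : E.domain) :
    ‖E.toDom u‖ ^ 2 = ‖(u : Lp ℝ 2 μ)‖ ^ 2 + E.form u u := by
  rw [← real_inner_self_eq_norm_sq, inner_toDom, real_inner_self_eq_norm_sq]

theorem norm_coe_le_toDom (u : E.domain) : ‖(u : Lp ℝ 2 μ)‖ ≤ ‖E.toDom u‖ := by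
  refine le_of_sq_le_sq ?_ (norm_nonneg _)
  rw [norm_toDom_sq]
  linarith [E.nonneg u]

theorem norm_toDom_approx_le (α : Set.Ioi (0 : ℝ)) (u : E.domain) :
    ‖E.toDom (E.approx α (u : Lp ℝ 2 μ))‖ ≤ ‖E.toDom u‖ := by
  refine le_of_sq_le_sq ?_ (norm_nonneg _)
  rw [norm_toDom_sq, norm_toDom_sq]
  have := E.norm_approx_le α (u : Lp ℝ 2 μ)
  have h2 := E.form_approx_le α u
  gcongr

/-- `α (α - Δ)⁻¹` as a bounded operator on `Dom ℰ`. -/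
noncomputable def approxD (α : Set.Ioi (0 : ℝ)) : E.DomSpace →L[ℝ] E.DomSpace :=
  (E.toDom ∘ₗ E.approx α ∘ₗ E.domain.subtype ∘ₗ E.ofDom).mkContinuous 1
    (fun u => by
      rw [one_mul]
      exact E.norm_toDom_approx_le α (E.ofDom u))

theorem norm_approxD_apply_le (α : Set.Ioi (0 : ℝ)) (u : E.DomSpace) : ‖E.approxD α u‖ ≤ ‖u‖ :=
  E.norm_toDom_approx_le α (E.ofDom u)

theorem approxD_toDom (α : Set.Ioi (0 : ℝ)) (u : E.domain) :
    E.approxD α (E.toDom u) = E.toDom (E.approx α (u : Lp ℝ 2 μ)) := rfl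

/-- The inclusion of `DomSpace` into `L²`. -/
noncomputable def domIncl : E.DomSpace →L[ℝ] Lp ℝ 2 μ :=
  (E.domain.subtype ∘ₗ E.ofDom).mkContinuous 1
    (fun u => by
      rw [one_mul]
      exact E.norm_coe_le_toDom (E.ofDom u))

theorem tendsto_approxL {a : ℕ → Set.Ioi (0 : ℝ)}
    (ha : Tendsto (fun n => (a n).1) atTop atTop) (f : Lp ℝ 2 μ) :
    Tendsto (fun n => E.approxL (a n) f) atTop (𝓝 f) := by
  refine tendsto_apply_of_dense (fun n => E.norm_approxL_apply_le (a n)) E.dense (fun x hx => ?_) f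
  rw [tendsto_iff_norm_sub_tendsto_zero]
  have h1 : Tendsto (fun n => E.form ⟨x, hx⟩ ⟨x, hx⟩ / (a n).1) atTop (𝓝 0) :=
    Tendsto.div_atTop tendsto_const_nhds ha
  have h2 := h1.sqrt
  rw [Real.sqrt_zero] at h2
  refine squeeze_zero (fun n => norm_nonneg _) (fun n => ?_) h2
  apply Real.le_sqrt_of_sq_le
  rw [norm_sub_rev]
  exact E.norm_sub_approx_sq_le (a n) ⟨x, hx⟩

/-- J_1 is the adjoint of the inclusion Dom ℰ → L²: ⟪J_1 g, v⟫ in Dom ℰ equals ⟪g, v⟫ in L². A v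
orthogonal to the range therefore has ⟪v, v⟫ = 0. -/
theorem dense_range_approx :
    Dense (Set.range fun g : Lp ℝ 2 μ => E.toDom (E.approx unitParam g)) := by
  have h : ((E.toDom ∘ₗ E.approx unitParam).range : Submodule ℝ E.DomSpace).topologicalClosure
      = ⊤ := by
    rw [Submodule.topologicalClosure_eq_top_iff, Submodule.eq_bot_iff]
    intro v hv
    rw [Submodule.mem_orthogonal] at hv
    have h1 := hv _ ⟨E.domIncl v, rfl⟩
    rw [← E.toDom_ofDom v, LinearMap.comp_apply, inner_toDom, form_approx, inner_sub_left] at h1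
    have h2 : inner ℝ (E.domIncl v) (E.domIncl v) = 0 := by
      have h4 : (unitParam.1 : ℝ) = 1 := rfl
      rw [h4, one_mul] at h1
      change inner ℝ (E.approx unitParam (E.domIncl v) : Lp ℝ 2 μ) (E.domIncl v)
        + (inner ℝ (E.domIncl v) (E.domIncl v)
          - inner ℝ (E.approx unitParam (E.domIncl v) : Lp ℝ 2 μ) (E.domIncl v)) = 0 at h1
      linarith
    exact Subtype.ext (inner_self_eq_zero.1 h2)
  have h2 := Submodule.dense_iff_topologicalClosure_eq_top.2 h
  exact h2

theorem tendsto_approxD {a : ℕ → Set.Ioi (0 : ℝ)}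
    (ha : Tendsto (fun n => (a n).1) atTop atTop) (u : E.DomSpace) :
    Tendsto (fun n => E.approxD (a n) u) atTop (𝓝 u) := by
  refine tendsto_apply_of_dense (fun n => E.norm_approxD_apply_le (a n)) E.dense_range_approx ?_ u
  rintro _ ⟨g, rfl⟩
  rw [tendsto_iff_norm_sub_tendsto_zero]
  have h1 := (E.tendsto_approxL ha g)
  rw [tendsto_iff_norm_sub_tendsto_zero] at h1
  have h2 := h1.mul_const 2
  rw [zero_mul] at h2
  refine squeeze_zero (fun n => norm_nonneg _) (fun n => ?_) h2
  dsimp only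
  -- On the range of J_1 the error is J_1(J_α g - g). As J_1 maps L² boundedly to Dom ℰ (norm at
  -- most 2), L² convergence suffices.
  rw [approxD_toDom, approx_comm, ← map_sub, ← map_sub, approxL_apply]
  set d := (E.approx (a n) g : Lp ℝ 2 μ) - g
  refine le_of_sq_le_sq ?_ (by positivity)
  rw [norm_toDom_sq, form_approx]
  have h3 := E.norm_approx_le unitParam d
  have h4 := real_inner_le_norm (d - (E.approx unitParam d : Lp ℝ 2 μ)) (E.approx unitParam d)
  have h5 := norm_sub_le d (E.approx unitParam d : Lp ℝ 2 μ)
  have h6 : (unitParam.1 : ℝ) = 1 := rfl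
  rw [h6, one_mul]
  have h7 := norm_nonneg (E.approx unitParam d : Lp ℝ 2 μ)
  have h8 := norm_nonneg d
  have h9 : ‖d - (E.approx unitParam d : Lp ℝ 2 μ)‖ * ‖(E.approx unitParam d : Lp ℝ 2 μ)‖
      ≤ (‖d‖ + ‖d‖) * ‖d‖ := by gcongr; linarith
  nlinarith

/-! ### The unit contraction and the resolvent -/

/-- J_α f is the unique minimizer of v ↦ ℰ(v,v) + α‖f - v‖². The unit contraction raises neither
term when 0 ≤ f ≤ 1, so it fixes the minimizer. -/
theorem approx_mem_Icc (α : Set.Ioi (0 : ℝ)) {f : Lp ℝ 2 μ} (hf0 : ∀ᵐ x ∂μ, 0 ≤ f x)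
    (hf1 : ∀ᵐ x ∂μ, f x ≤ 1) :
    ∀ᵐ x ∂μ, 0 ≤ (E.approx α f : Lp ℝ 2 μ) x ∧ (E.approx α f : Lp ℝ 2 μ) x ≤ 1 := by
  obtain ⟨v, hv, hvE⟩ := E.markov (E.approx α f)
  set u := E.approx α f with hu
  have hnorm : ‖f - (v : Lp ℝ 2 μ)‖ ≤ ‖f - (u : Lp ℝ 2 μ)‖ := by
    refine Lp.norm_le_norm_of_ae_le ?_
    filter_upwards [hv, hf0, hf1, Lp.coeFn_sub f (v : Lp ℝ 2 μ), Lp.coeFn_sub f (u : Lp ℝ 2 μ)]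
      with x hx h0 h1 h2 h3
    rw [h2, h3, Pi.sub_apply, Pi.sub_apply, hx, Real.norm_eq_abs, Real.norm_eq_abs]
    rcases le_total ((u : Lp ℝ 2 μ) x) 0 with h | h
    · rw [max_eq_right h, min_eq_left zero_le_one, abs_of_nonneg (by linarith),
        abs_of_nonneg (by linarith)]
      linarith
    · rw [max_eq_left h]
      rcases le_total ((u : Lp ℝ 2 μ) x) 1 with h' | h'
      · rw [min_eq_left h']
      · rw [min_eq_right h', abs_of_nonpos (by linarith), abs_of_nonpos (by linarith)]
        linarith
  have heq : v - u = 0 := by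
    refine E.add_sq_form_nonneg_eq_zero (α := α.1) α.2 ?_
    have h1 := E.form_approx α f (v - u)
    rw [← hu] at h1
    have h2 : ‖f - (v : Lp ℝ 2 μ)‖ ^ 2 ≤ ‖f - (u : Lp ℝ 2 μ)‖ ^ 2 := by gcongr
    have h3 : f - (v : Lp ℝ 2 μ) = (f - (u : Lp ℝ 2 μ)) - ((v - u : E.domain) : Lp ℝ 2 μ) := by
      rw [Submodule.coe_sub]; abel
    rw [h3, norm_sub_sq_real] at h2
    have h4 : E.form (v - u) (v - u) = E.form v v - E.form u u - 2 * E.form u (v - u) := by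
      simp only [map_sub, LinearMap.sub_apply, E.symm v u]; ring
    rw [h4, h1]
    have := mul_le_mul_of_nonneg_left h2 (le_of_lt (Set.mem_Ioi.1 α.2))
    linarith
  rw [sub_eq_zero] at heq
  rw [heq] at hv
  filter_upwards [hv] with x hx
  rw [hx]
  exact ⟨le_min (le_max_right _ _) zero_le_one, min_le_right _ _⟩

end DirichletForm

open NormedSpace in
theorem exp_apply_intertwine {H K : Type*} [NormedAddCommGroup H] [NormedSpace ℝ H]
    [CompleteSpace H] [NormedAddCommGroup K] [NormedSpace ℝ K] [CompleteSpace K]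
    {A : H →L[ℝ] H} {B : K →L[ℝ] K} (ι : H →L[ℝ] K) (h : ∀ x, ι (A x) = B (ι x)) (x : H) :
    ι (exp A x) = exp B (ι x) := by
  have hA : HasSum (fun n : ℕ => ι (((n.factorial : ℝ)⁻¹ • A ^ n) x)) (ι (exp A x)) :=
    ((exp_series_hasSum_exp' (𝕂 := ℝ) A).mapL (ContinuousLinearMap.apply ℝ H x)).mapL ι
  have hB : HasSum (fun n : ℕ => ((n.factorial : ℝ)⁻¹ • B ^ n) (ι x)) (exp B (ι x)) :=
    (exp_series_hasSum_exp' (𝕂 := ℝ) B).mapL (ContinuousLinearMap.apply ℝ K (ι x))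
  have hpow : ∀ (n : ℕ) (x : H), ι ((A ^ n) x) = (B ^ n) (ι x) := by
    intro n
    induction n with
    | zero => intro x; rfl
    | succ k ih =>
      intro x
      rw [pow_succ, pow_succ]
      exact (ih (A x)).trans (by rw [h]; rfl)
  refine hA.unique ?_
  convert hB using 2 with n
  rw [smul_apply, smul_apply, map_smul, hpow]

/-! ### Averages over an exponential time -/

/-- The exponential distribution of rate `α`. -/
noncomputable def laplaceMeasure (α : ℝ) : Measure ℝ :=
  (volume.restrict (Set.Ioi (0 : ℝ))).withDensity fun t => ENNReal.ofReal (α * Real.exp (-α * t))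

theorem isProbabilityMeasure_laplaceMeasure {α : ℝ} (hα : 0 < α) :
    IsProbabilityMeasure (laplaceMeasure α) := by
  constructor
  rw [laplaceMeasure, withDensity_apply _ MeasurableSet.univ, Measure.restrict_univ,
    ← ofReal_integral_eq_lintegral_ofReal
      ((integrableOn_exp_mul_Ioi (neg_lt_zero.2 hα) 0).const_mul α)
      (Eventually.of_forall fun t => by positivity), integral_const_mul,
    integral_exp_mul_Ioi (neg_lt_zero.2 hα)]
  simp [hα.ne']

theorem integral_laplaceMeasure {H : Type*} [NormedAddCommGroup H] [NormedSpace ℝ H] {α : ℝ}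
    (hα : 0 < α) (f : ℝ → H) :
    ∫ t, f t ∂laplaceMeasure α
      = α • ∫ t in Set.Ioi (0 : ℝ), Real.exp (-α * t) • f t := by
  rw [laplaceMeasure, integral_withDensity_eq_integral_toReal_smul (by fun_prop)
    (Eventually.of_forall fun t => ENNReal.ofReal_lt_top), ← integral_smul]
  refine integral_congr_ae (Eventually.of_forall fun t => ?_)
  dsimp only
  rw [ENNReal.toReal_ofReal (by positivity), mul_smul]

theorem ae_laplaceMeasure_nonneg (α : ℝ) : ∀ᵐ t ∂laplaceMeasure α, 0 ≤ t := by
  refine (withDensity_absolutelyContinuous _ _).ae_le ?_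
  exact (ae_restrict_iff' measurableSet_Ioi).2 (Eventually.of_forall fun t ht => le_of_lt ht)

namespace DirichletForm

variable {X : Type u} [MeasurableSpace X] {μ : Measure X} (E : DirichletForm μ)

/-! ### The heat semigroup -/

/-- The parameter `n + 1`. -/
def natParam (n : ℕ) : Set.Ioi (0 : ℝ) := ⟨(n : ℝ) + 1, Set.mem_Ioi.2 (Nat.cast_add_one_pos n)⟩

theorem tendsto_natParam : Tendsto (fun n => (natParam n).1) atTop atTop :=
  tendsto_atTop_add_const_right _ _ tendsto_natCast_atTop_atTop

theorem yosida_eq (α : Set.Ioi (0 : ℝ)) : E.yosida α = α.1 • (E.approxL α - 1) := rfl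

/-- The Yosida approximation on `Dom ℰ`. -/
noncomputable def yosidaD (α : Set.Ioi (0 : ℝ)) : E.DomSpace →L[ℝ] E.DomSpace :=
  α.1 • (E.approxD α - 1)

theorem domIncl_approxD (α : Set.Ioi (0 : ℝ)) (u : E.DomSpace) :
    E.domIncl (E.approxD α u) = E.approxL α (E.domIncl u) := rfl

theorem domIncl_yosidaD (α : Set.Ioi (0 : ℝ)) (u : E.DomSpace) :
    E.domIncl (E.yosidaD α u) = E.yosida α (E.domIncl u) := by
  rw [yosidaD, yosida_eq, smul_apply, smul_apply, map_smul, sub_apply, sub_apply, map_sub,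
    domIncl_approxD]
  rfl

theorem domIncl_injective : Function.Injective E.domIncl := fun _ _ h => Subtype.ext h

open NormedSpace in
theorem norm_exp_yosida_apply_le (α : Set.Ioi (0 : ℝ)) {s : ℝ} (hs : 0 ≤ s) (f : Lp ℝ 2 μ) :
    ‖exp (s • E.yosida α) f‖ ≤ ‖f‖ := by
  rw [yosida_eq, smul_smul]
  exact norm_exp_smul_sub_one_apply_le (ContinuousLinearMap.opNorm_le_bound _ zero_le_one
    fun x => by rw [one_mul]; exact E.norm_approxL_apply_le α x)
    (mul_nonneg hs (le_of_lt α.2)) f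

open NormedSpace in
theorem norm_exp_yosidaD_apply_le (α : Set.Ioi (0 : ℝ)) {s : ℝ} (hs : 0 ≤ s) (u : E.DomSpace) :
    ‖exp (s • E.yosidaD α) u‖ ≤ ‖u‖ := by
  rw [yosidaD, smul_smul]
  exact norm_exp_smul_sub_one_apply_le (ContinuousLinearMap.opNorm_le_bound _ zero_le_one
    fun x => by rw [one_mul]; exact E.norm_approxD_apply_le α x)
    (mul_nonneg hs (le_of_lt α.2)) u

theorem commute_approxL (α β : Set.Ioi (0 : ℝ)) : Commute (E.approxL α) (E.approxL β) :=
  ContinuousLinearMap.ext fun f => congrArg Subtype.val (E.approx_comm α β f)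

theorem commute_yosida (α β : Set.Ioi (0 : ℝ)) : Commute (E.yosida α) (E.yosida β) := by
  rw [yosida_eq, yosida_eq]
  exact ((((E.commute_approxL α β).sub_right (Commute.one_right _)).sub_left
    (Commute.one_left _)).smul_right _).smul_left _

theorem commute_yosidaD (α β : Set.Ioi (0 : ℝ)) : Commute (E.yosidaD α) (E.yosidaD β) := by
  refine ContinuousLinearMap.ext fun u => E.domIncl_injective ?_
  change E.domIncl (E.yosidaD α (E.yosidaD β u)) = E.domIncl (E.yosidaD β (E.yosidaD α u))
  simp only [domIncl_yosidaD]
  exact congrArg (fun T : Lp ℝ 2 μ →L[ℝ] Lp ℝ 2 μ => T (E.domIncl u)) (E.commute_yosida α β)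

/-- The Yosida operator is J_β Δ on the domain of Δ, and Δ J_α f = α(J_α f - f). Hence the Yosida
approximations converge on the ranges of the J_α, which are dense together. -/
theorem yosida_approxL (α β : Set.Ioi (0 : ℝ)) (f : Lp ℝ 2 μ) :
    E.yosida β (E.approxL α f) = E.approxL β (α.1 • (E.approxL α f - f)) := by
  have h := congrArg (fun v : E.domain => (v : Lp ℝ 2 μ)) (E.smul_approx_sub α β f)
  rw [map_smul, map_sub]
  exact h

theorem yosidaD_approxD (α β : Set.Ioi (0 : ℝ)) (u : E.DomSpace) :
    E.yosidaD β (E.approxD α u) = E.approxD β (α.1 • (E.approxD α u - u)) := by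
  apply E.domIncl_injective
  rw [domIncl_yosidaD, domIncl_approxD, domIncl_approxD, yosida_approxL, map_smul E.domIncl,
    map_sub E.domIncl, domIncl_approxD]

theorem tendsto_yosida_approxL (α : Set.Ioi (0 : ℝ)) (f : Lp ℝ 2 μ) :
    Tendsto (fun n => E.yosida (natParam n) (E.approxL α f)) atTop
      (𝓝 (α.1 • (E.approxL α f - f))) := by
  simp only [yosida_approxL]
  exact E.tendsto_approxL tendsto_natParam _

open NormedSpace in
theorem tendsto_heat {t : ℝ} (ht : 0 ≤ t) (f : Lp ℝ 2 μ) :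
    Tendsto (fun n => exp (t • E.yosida (natParam n)) f) atTop (𝓝 (E.heat t f)) := by
  have hD : Dense (⋃ α : Set.Ioi (0 : ℝ), Set.range (E.approxL α)) := fun g =>
    mem_closure_of_tendsto (E.tendsto_approxL tendsto_natParam g)
      (Eventually.of_forall fun n => Set.mem_iUnion.2 ⟨natParam n, g, rfl⟩)
  refine tendsto_nhds_limUnder (exists_tendsto_exp_smul (A := fun n => E.yosida (natParam n))
    (fun m n => E.commute_yosida _ _)
    (fun n s hs => E.norm_exp_yosida_apply_le (natParam n) hs) hD ?_ ht f)
  intro x hx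
  obtain ⟨α, g, rfl⟩ := Set.mem_iUnion.1 hx
  exact (E.tendsto_yosida_approxL α g).cauchySeq

/-- The heat semigroup on `Dom ℰ`. -/
noncomputable def heatD (t : ℝ) (u : E.DomSpace) : E.DomSpace :=
  limUnder atTop fun n : ℕ => NormedSpace.exp (t • E.yosidaD (natParam n)) u

-- Convergence in the form norm, not just in L², is needed because Γ is continuous only on Dom ℰ.
open NormedSpace in
theorem tendsto_heatD {t : ℝ} (ht : 0 ≤ t) (u : E.DomSpace) :
    Tendsto (fun n => exp (t • E.yosidaD (natParam n)) u) atTop (𝓝 (E.heatD t u)) := by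
  have hD : Dense (⋃ α : Set.Ioi (0 : ℝ), Set.range (E.approxD α)) := fun g =>
    mem_closure_of_tendsto (E.tendsto_approxD tendsto_natParam g)
      (Eventually.of_forall fun n => Set.mem_iUnion.2 ⟨natParam n, g, rfl⟩)
  refine tendsto_nhds_limUnder (exists_tendsto_exp_smul (A := fun n => E.yosidaD (natParam n))
    (fun m n => E.commute_yosidaD _ _)
    (fun n s hs => E.norm_exp_yosidaD_apply_le (natParam n) hs) hD ?_ ht u)
  intro x hx
  obtain ⟨α, g, rfl⟩ := Set.mem_iUnion.1 hx
  simp only [yosidaD_approxD]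
  exact (E.tendsto_approxD tendsto_natParam _).cauchySeq

theorem norm_heat_le {t : ℝ} (ht : 0 ≤ t) (f : Lp ℝ 2 μ) : ‖E.heat t f‖ ≤ ‖f‖ :=
  le_of_tendsto (E.tendsto_heat ht f).norm
    (Eventually.of_forall fun n => E.norm_exp_yosida_apply_le (natParam n) ht f)

theorem norm_heatD_le {t : ℝ} (ht : 0 ≤ t) (u : E.DomSpace) : ‖E.heatD t u‖ ≤ ‖u‖ :=
  le_of_tendsto (E.tendsto_heatD ht u).norm
    (Eventually.of_forall fun n => E.norm_exp_yosidaD_apply_le (natParam n) ht u)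

theorem domIncl_heatD {t : ℝ} (ht : 0 ≤ t) (u : E.DomSpace) :
    E.domIncl (E.heatD t u) = E.heat t (E.domIncl u) := by
  refine tendsto_nhds_unique ((E.domIncl.continuous.tendsto _).comp (E.tendsto_heatD ht u)) ?_
  refine (E.tendsto_heat ht (E.domIncl u)).congr fun n => ?_
  refine (exp_apply_intertwine E.domIncl (fun x => ?_) u).symm
  rw [smul_apply, smul_apply, map_smul, domIncl_yosidaD]

theorem continuous_exp_smul_apply {H : Type*} [NormedAddCommGroup H] [NormedSpace ℝ H]
    [CompleteSpace H] (A : H →L[ℝ] H) (x : H) :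
    Continuous fun t : ℝ => NormedSpace.exp (t • A) x := by
  have : Continuous fun t : ℝ => NormedSpace.exp (t • A) :=
    continuous_iff_continuousAt.2 fun t => (hasDerivAt_exp_smul_const A t).continuousAt
  exact this.clm_apply continuous_const

theorem integrable_heat {α : ℝ} (hα : 0 < α) (f : Lp ℝ 2 μ) :
    Integrable (fun t => E.heat t f) (laplaceMeasure α) := by
  have := isProbabilityMeasure_laplaceMeasure hα
  refine Integrable.mono' (integrable_const ‖f‖) ?_ ?_
  · refine aestronglyMeasurable_of_tendsto_ae atTop
      (fun n => (continuous_exp_smul_apply (E.yosida (natParam n)) f).aestronglyMeasurable) ?_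
    filter_upwards [ae_laplaceMeasure_nonneg α] with t ht using E.tendsto_heat ht f
  · filter_upwards [ae_laplaceMeasure_nonneg α] with t ht using E.norm_heat_le ht f

theorem integrable_heatD {α : ℝ} (hα : 0 < α) (u : E.DomSpace) :
    Integrable (fun t => E.heatD t u) (laplaceMeasure α) := by
  have := isProbabilityMeasure_laplaceMeasure hα
  refine Integrable.mono' (integrable_const ‖u‖) ?_ ?_
  · refine aestronglyMeasurable_of_tendsto_ae atTop
      (fun n => (continuous_exp_smul_apply (E.yosidaD (natParam n)) u).aestronglyMeasurable) ?_
    filter_upwards [ae_laplaceMeasure_nonneg α] with t ht using E.tendsto_heatD ht u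
  · filter_upwards [ae_laplaceMeasure_nonneg α] with t ht using E.norm_heatD_le ht u

/-- `α (α - Δ)⁻¹` is the Laplace transform of the heat semigroup. -/
theorem integral_heat (α : Set.Ioi (0 : ℝ)) (f : Lp ℝ 2 μ) :
    ∫ t, E.heat t f ∂laplaceMeasure α.1 = E.approxL α f := by
  have hα : (0 : ℝ) < α.1 := α.2
  -- The datum is α f: then αy - x = α(J_α f - f), which is the limit of the Yosida approximations
  -- at y = J_α f.
  have h := integral_exp_smul_of_tendsto (A := fun n => E.yosida (natParam n)) (P := E.heat)
    (fun n s hs => E.norm_exp_yosida_apply_le (natParam n) hs)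
    (fun t ht x => E.tendsto_heat ht x) hα (x := α.1 • f) (y := E.approxL α f) ?_
  · rw [integral_laplaceMeasure hα, ← h, ← integral_smul]
    refine setIntegral_congr_fun measurableSet_Ioi fun t ht => ?_
    have h1 : E.heat t (α.1 • f) = α.1 • E.heat t f := by
      refine tendsto_nhds_unique (E.tendsto_heat (le_of_lt ht) _) ?_
      simp only [map_smul]
      exact (E.tendsto_heat (le_of_lt ht) f).const_smul α.1
    rw [h1, smul_comm]
  · rw [← smul_sub]
    exact E.tendsto_yosida_approxL α f

theorem integral_heatD (α : Set.Ioi (0 : ℝ)) (u : E.DomSpace) :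
    ∫ t, E.heatD t u ∂laplaceMeasure α.1 = E.approxD α u := by
  apply E.domIncl_injective
  rw [domIncl_approxD, ← integral_heat, ← E.domIncl.integral_comp_comm (E.integrable_heatD α.2 u)]
  refine integral_congr_ae ?_
  filter_upwards [ae_laplaceMeasure_nonneg α.1] with t ht using E.domIncl_heatD ht u

end DirichletForm

/-! ### Pointwise Cauchy–Schwarz inequalities -/

section BilinearL1

variable {X : Type u} [MeasurableSpace X] {μ : Measure X} {V : Type*} [AddCommGroup V] [Module ℝ V]
  {B : V →ₗ[ℝ] V →ₗ[ℝ] Lp ℝ 1 μ}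

/-- The pointwise Cauchy–Schwarz inequality for nonnegative `L¹`-valued bilinear maps. -/
theorem ae_sq_le_mul (hs : ∀ f g, B f g = B g f) (hB : ∀ f, ∀ᵐ x ∂μ, 0 ≤ B f f x) (f g : V) :
    ∀ᵐ x ∂μ, B f g x ^ 2 ≤ B f f x * B g g x := by
  -- Rational q only, so that countably many null sets are discarded; real coefficients follow by
  -- density, and the discriminant finishes.
  have h1 : ∀ᵐ x ∂μ, ∀ q : ℚ, 0 ≤ B f f x * ((q : ℝ) * q) + 2 * B f g x * q + B g g x := by
    refine ae_all_iff.2 fun q => ?_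
    have h2 : B ((q : ℝ) • f + g) ((q : ℝ) • f + g)
        = ((q : ℝ) * q) • B f f + (2 * q : ℝ) • B f g + B g g := by
      simp only [map_add, map_smul, LinearMap.add_apply, LinearMap.smul_apply, hs g f, smul_add,
        smul_smul, two_mul, add_smul]
      abel
    have h3 := hB ((q : ℝ) • f + g)
    rw [h2] at h3
    filter_upwards [h3, Lp.coeFn_add (((q : ℝ) * q) • B f f + (2 * q : ℝ) • B f g) (B g g),
      Lp.coeFn_add (((q : ℝ) * q) • B f f) ((2 * q : ℝ) • B f g),
      Lp.coeFn_smul ((q : ℝ) * q) (B f f), Lp.coeFn_smul (2 * q : ℝ) (B f g)] with x a b c d e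
    rw [b, Pi.add_apply, c, Pi.add_apply, d, e, Pi.smul_apply, Pi.smul_apply, smul_eq_mul,
      smul_eq_mul] at a
    linarith
  filter_upwards [h1] with x hx
  have h4 : ∀ r : ℝ, 0 ≤ B f f x * (r * r) + 2 * B f g x * r + B g g x := fun r =>
    Rat.denseRange_cast.induction_on
      (p := fun r => 0 ≤ B f f x * (r * r) + 2 * B f g x * r + B g g x) r
      (isClosed_le continuous_const (by fun_prop)) hx
  have := discrim_le_zero h4
  rw [discrim] at this
  nlinarith

theorem memLp_sqrt_of_integrable {γ : X → ℝ}
    (hi : Integrable γ μ) (h : ∀ᵐ x ∂μ, 0 ≤ γ x) : MemLp (fun x => √(γ x)) 2 μ := by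
  rw [memLp_two_iff_integrable_sq (Real.continuous_sqrt.comp_aestronglyMeasurable hi.1)]
  refine hi.congr ?_
  filter_upwards [h] with x hx using (Real.sq_sqrt hx).symm

theorem memLp_sqrt_of_nonneg {γ : Lp ℝ 1 μ} (h : ∀ᵐ x ∂μ, 0 ≤ γ x) :
    MemLp (fun x => √(γ x)) 2 μ :=
  memLp_sqrt_of_integrable (L1.integrable_coeFn γ) h

theorem integral_sqrt_mul_sqrt_le {γ δ : X → ℝ} (hγ : ∀ᵐ x ∂μ, 0 ≤ γ x) (hδ : ∀ᵐ x ∂μ, 0 ≤ δ x)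
    (hγi : MemLp (fun x => √(γ x)) 2 μ) (hδi : MemLp (fun x => √(δ x)) 2 μ) :
    Integrable (fun x => √(γ x) * √(δ x)) μ ∧
    ∫ x, √(γ x) * √(δ x) ∂μ ≤ √(∫ x, γ x ∂μ) * √(∫ x, δ x ∂μ) := by
  refine ⟨hγi.integrable_mul hδi, ?_⟩
  have h1 := integral_mul_le_Lp_mul_Lq_of_nonneg Real.HolderConjugate.two_two
    (Eventually.of_forall fun x => Real.sqrt_nonneg (γ x))
    (Eventually.of_forall fun x => Real.sqrt_nonneg (δ x)) (by simpa using hγi) (by simpa using hδi)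
  have h2 : ∀ {γ : X → ℝ}, (∀ᵐ x ∂μ, 0 ≤ γ x) → ∫ x, √(γ x) ^ (2 : ℝ) ∂μ = ∫ x, γ x ∂μ := by
    intro γ h
    refine integral_congr_ae ?_
    filter_upwards [h] with x hx
    rw [Real.rpow_two, Real.sq_sqrt hx]
  rw [h2 hγ, h2 hδ, ← Real.sqrt_eq_rpow, ← Real.sqrt_eq_rpow] at h1
  exact h1

theorem norm_le_sqrt_mul_sqrt (hs : ∀ f g, B f g = B g f) (hB : ∀ f, ∀ᵐ x ∂μ, 0 ≤ B f f x)
    (f g : V) : ‖B f g‖ ≤ √(∫ x, B f f x ∂μ) * √(∫ x, B g g x ∂μ) := by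
  have h := integral_sqrt_mul_sqrt_le (hB f) (hB g) (memLp_sqrt_of_nonneg (hB f))
    (memLp_sqrt_of_nonneg (hB g))
  rw [L1.norm_eq_integral_norm]
  refine (integral_mono_ae (L1.integrable_coeFn _).norm h.1 ?_).trans h.2
  filter_upwards [ae_sq_le_mul hs hB f g, hB f] with x hx hf
  rw [← Real.sqrt_mul hf, Real.norm_eq_abs]
  exact Real.abs_le_sqrt hx

theorem abs_integral_le_norm (γ : Lp ℝ 1 μ) : |∫ x, γ x ∂μ| ≤ ‖γ‖ := by
  rw [L1.norm_eq_integral_norm, ← Real.norm_eq_abs]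
  exact norm_integral_le_integral_norm _

end BilinearL1

theorem inner_eq_integral_mul {X : Type u} [MeasurableSpace X] {μ : Measure X} (f g : Lp ℝ 2 μ) :
    inner ℝ f g = ∫ x, f x * g x ∂μ := by
  rw [L2.inner_def]
  exact integral_congr_ae (Eventually.of_forall fun x => mul_comm _ _)

theorem integrable_mul_L2 {X : Type u} [MeasurableSpace X] {μ : Measure X} (f g : Lp ℝ 2 μ) :
    Integrable (fun x => f x * g x) μ :=
  (Lp.memLp f).integrable_mul (Lp.memLp g)

theorem inner_le_inner_of_ae_le {X : Type u} [MeasurableSpace X] {μ : Measure X} {h p q : Lp ℝ 2 μ}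
    (hh : ∀ᵐ x ∂μ, 0 ≤ h x) (hpq : ∀ᵐ x ∂μ, p x ≤ q x) : inner ℝ h p ≤ inner ℝ h q := by
  rw [inner_eq_integral_mul, inner_eq_integral_mul]
  refine integral_mono_ae (integrable_mul_L2 h p) (integrable_mul_L2 h q) ?_
  filter_upwards [hh, hpq] with x h1 h2
  gcongr

/-! ### The seminorm √Γ and the Bakry–Émery estimate for resolvents -/

namespace CarreDuChamp

variable {X : Type u} [MeasurableSpace X] {μ : Measure X} {E : DirichletForm μ}
  (Γ : CarreDuChamp E)

theorem exists_integral_gamma_le :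
    ∃ K : NNReal, ∀ f : E.domain, √(∫ x, Γ.gamma f f x ∂μ) ≤ K * ‖E.toDom f‖ := by
  obtain ⟨M, hM⟩ := Γ.continuous
  refine ⟨Real.toNNReal √|M|, fun f => ?_⟩
  rw [Real.coe_toNNReal _ (Real.sqrt_nonneg _), ← Real.sqrt_sq (norm_nonneg (E.toDom f)),
    ← Real.sqrt_mul (abs_nonneg _)]
  refine Real.sqrt_le_sqrt ?_
  rw [E.norm_toDom_sq]
  calc _ ≤ ‖Γ.gamma f f‖ := (le_abs_self _).trans (abs_integral_le_norm _)
    _ ≤ M * (E.form f f + ‖(f : Lp ℝ 2 μ)‖ ^ 2) := hM f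
    _ ≤ |M| * (‖(f : Lp ℝ 2 μ)‖ ^ 2 + E.form f f) := by
      rw [add_comm]
      have := E.nonneg f
      gcongr
      exact le_abs_self _

theorem coeFn_sqrtGamma (f : E.domain) :
    ∀ᵐ x ∂μ, Γ.sqrtGamma f x = √(Γ.gamma f f x) := (Γ.memLp_sqrt_gamma f).coeFn_toLp

theorem norm_sqrtGamma (f : E.domain) : ‖Γ.sqrtGamma f‖ = √(∫ x, Γ.gamma f f x ∂μ) := by
  rw [← Real.sqrt_sq (norm_nonneg (Γ.sqrtGamma f)), ← real_inner_self_eq_norm_sq,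
    inner_eq_integral_mul]
  congr 1
  refine integral_congr_ae ?_
  filter_upwards [Γ.coeFn_sqrtGamma f, Γ.nonneg f] with x h1 h2
  rw [h1, Real.mul_self_sqrt h2]

theorem sqrtGamma_add_le (f g : E.domain) :
    ∀ᵐ x ∂μ, Γ.sqrtGamma (f + g) x ≤ (Γ.sqrtGamma f + Γ.sqrtGamma g : Lp ℝ 2 μ) x := by
  have h2 : Γ.gamma (f + g) (f + g) = Γ.gamma f f + (2 : ℝ) • Γ.gamma f g + Γ.gamma g g := by
    simp only [map_add, LinearMap.add_apply, Γ.symm g f, two_smul]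
    abel
  filter_upwards [Γ.coeFn_sqrtGamma f, Γ.coeFn_sqrtGamma g, Γ.coeFn_sqrtGamma (f + g),
    Lp.coeFn_add (Γ.sqrtGamma f) (Γ.sqrtGamma g),
    Lp.coeFn_add (Γ.gamma f f + (2 : ℝ) • Γ.gamma f g) (Γ.gamma g g),
    Lp.coeFn_add (Γ.gamma f f) ((2 : ℝ) • Γ.gamma f g),
    Lp.coeFn_smul (2 : ℝ) (Γ.gamma f g), ae_sq_le_mul Γ.symm Γ.nonneg f g, Γ.nonneg f, Γ.nonneg g]
    with x a b c d e e1 e2 h h3 h4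
  rw [c, d, Pi.add_apply, a, b, h2, e, Pi.add_apply, e1, Pi.add_apply, e2, Pi.smul_apply,
    smul_eq_mul]
  refine Real.sqrt_le_iff.2 ⟨by positivity, ?_⟩
  have h5 := (le_abs_self _).trans (Real.abs_le_sqrt h)
  rw [Real.sqrt_mul h3] at h5
  rw [add_sq, Real.sq_sqrt h3, Real.sq_sqrt h4]
  linarith

theorem sqrtGamma_smul {c : ℝ} (hc : 0 ≤ c) (f : E.domain) :
    Γ.sqrtGamma (c • f) = c • Γ.sqrtGamma f := by
  apply Lp.ext
  have h : Γ.gamma (c • f) (c • f) = (c * c) • Γ.gamma f f := by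
    simp only [map_smul, LinearMap.smul_apply, smul_smul]
  filter_upwards [Γ.coeFn_sqrtGamma f, Γ.coeFn_sqrtGamma (c • f), Lp.coeFn_smul c (Γ.sqrtGamma f),
    Lp.coeFn_smul (c * c) (Γ.gamma f f)] with x a b d e
  rw [b, h, e, d, Pi.smul_apply, Pi.smul_apply, a, smul_eq_mul, smul_eq_mul,
    Real.sqrt_mul (mul_self_nonneg c), Real.sqrt_mul_self hc]

theorem inner_sqrtGamma_add_le {h : Lp ℝ 2 μ} (hh : ∀ᵐ x ∂μ, 0 ≤ h x) (f g : E.domain) :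
    inner ℝ h (Γ.sqrtGamma (f + g)) ≤ inner ℝ h (Γ.sqrtGamma f) + inner ℝ h (Γ.sqrtGamma g) := by
  rw [← inner_add_right]
  exact inner_le_inner_of_ae_le hh (Γ.sqrtGamma_add_le f g)

theorem continuous_inner_sqrtGamma {h : Lp ℝ 2 μ} (hh : ∀ᵐ x ∂μ, 0 ≤ h x) :
    Continuous fun u : E.DomSpace => inner ℝ h (Γ.sqrtGamma (E.ofDom u)) := by
  obtain ⟨K, hK⟩ := Γ.exists_integral_gamma_le
  refine (LipschitzWith.of_le_add_mul (‖h‖₊ * K) fun u v => ?_).continuous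
  have h1 := Γ.inner_sqrtGamma_add_le hh (E.ofDom v) (E.ofDom (u - v))
  rw [← map_add, add_sub_cancel] at h1
  refine h1.trans (add_le_add le_rfl ((real_inner_le_norm _ _).trans ?_))
  rw [norm_sqrtGamma, dist_eq_norm, NNReal.coe_mul, coe_nnnorm, mul_assoc]
  gcongr
  exact hK _

/-- Pairing with a nonnegative h turns the pointwise seminorm √Γ into a scalar convex functional on
Dom ℰ, to which Jensen's inequality for Bochner integrals applies. -/
theorem convexOn_inner_sqrtGamma {h : Lp ℝ 2 μ} (hh : ∀ᵐ x ∂μ, 0 ≤ h x) :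
    ConvexOn ℝ Set.univ fun u : E.DomSpace => inner ℝ h (Γ.sqrtGamma (E.ofDom u)) := by
  refine ⟨convex_univ, fun u _ v _ a b ha hb _ => ?_⟩
  have h1 := Γ.inner_sqrtGamma_add_le hh (E.ofDom (a • u)) (E.ofDom (b • v))
  rw [← map_add] at h1
  refine h1.trans (le_of_eq ?_)
  rw [map_smul, map_smul, Γ.sqrtGamma_smul ha, Γ.sqrtGamma_smul hb, inner_smul_right,
    inner_smul_right]
  rfl

variable {Γ}

/-- The weak Bakry–Émery estimate for the resolvent. -/
theorem WeakBakryEmery.inner_sqrtGamma_approx_le {C₁ : ℝ} (hΓ : Γ.WeakBakryEmery C₁ 0)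
    (α : Set.Ioi (0 : ℝ)) {h : Lp ℝ 2 μ} (hh : ∀ᵐ x ∂μ, 0 ≤ h x) (u : E.domain) :
    inner ℝ h (Γ.sqrtGamma (E.approx α (u : Lp ℝ 2 μ)))
      ≤ C₁ * inner ℝ (E.approx α h : Lp ℝ 2 μ) (Γ.sqrtGamma u) := by
  have := isProbabilityMeasure_laplaceMeasure (Set.mem_Ioi.1 α.2)
  obtain ⟨K, hK⟩ := Γ.exists_integral_gamma_le
  have hint := E.integrable_heatD (Set.mem_Ioi.1 α.2) (E.toDom u)
  have hint2 := E.integrable_heat (Set.mem_Ioi.1 α.2) (Γ.sqrtGamma u)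
  have hNint : Integrable (fun t => inner ℝ h (Γ.sqrtGamma (E.ofDom (E.heatD t (E.toDom u)))))
      (laplaceMeasure α.1) := by
    refine Integrable.mono' (hint.norm.const_mul (‖h‖ * K))
      ((Γ.continuous_inner_sqrtGamma hh).comp_aestronglyMeasurable hint.1)
      (Eventually.of_forall fun t => ?_)
    refine (norm_inner_le_norm _ _).trans ?_
    rw [norm_sqrtGamma, mul_assoc]
    gcongr
    exact hK _
  -- Jensen for the exponential law of t: the mean of P_t u in Dom ℰ is J_α u.
  have h1 := (Γ.convexOn_inner_sqrtGamma hh).map_integral_le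
    (Γ.continuous_inner_sqrtGamma hh).continuousOn isClosed_univ
    (Eventually.of_forall fun _ => Set.mem_univ _) hint hNint
  rw [E.integral_heatD] at h1
  have h2 : ∫ t, inner ℝ h (Γ.sqrtGamma (E.ofDom (E.heatD t (E.toDom u)))) ∂laplaceMeasure α.1
      ≤ ∫ t, C₁ * inner ℝ h (E.heat t (Γ.sqrtGamma u)) ∂laplaceMeasure α.1 := by
    refine integral_mono_ae hNint ((hint2.const_inner h).const_mul C₁) ?_
    filter_upwards [ae_laplaceMeasure_nonneg α.1] with t ht
    rw [← real_inner_smul_right]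
    refine inner_le_inner_of_ae_le hh ?_
    filter_upwards [hΓ t ht u (E.ofDom (E.heatD t (E.toDom u))) (E.domIncl_heatD ht (E.toDom u)),
      Lp.coeFn_smul C₁ (E.heat t (Γ.sqrtGamma u))] with x hx hx2
    rw [hx2, Pi.smul_apply, smul_eq_mul]
    simpa using hx
  -- Averaging P_t gives J_α √Γ(u), and symmetry moves J_α onto the test function h.
  rw [integral_const_mul, integral_inner hint2, E.integral_heat, E.approxL_apply,
    ← E.inner_approx_comm] at h2
  exact h1.trans h2

end CarreDuChamp

/-- Riemann sums of `2 ∫₀^M (x - min x s) ds = x²`. -/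
theorem abs_sum_sub_min_sub_sq_le {M x : ℝ} (hx0 : 0 ≤ x) (hxM : x ≤ M) (n : ℕ) :
    |∑ k ∈ Finset.range (n + 1), 2 * (M / (n + 1)) * (x - min x (k * (M / (n + 1)))) - x ^ 2|
      ≤ M ^ 2 / (n + 1) := by
  set δ := M / ((n : ℝ) + 1) with hδ
  have hn : (0 : ℝ) < (n : ℝ) + 1 := by positivity
  have hδ0 : 0 ≤ δ := div_nonneg (hx0.trans hxM) hn.le
  have hM : ((n : ℝ) + 1) * δ = M := by rw [hδ]; field_simp
  set a : ℕ → ℝ := fun k => x - min x (k * δ) with ha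
  -- Here a_k = (x - kδ)⁺. The squares telescope to x², and each Riemann term exceeds its decrement
  -- by at most δ²; n + 1 such errors add up to M²/(n + 1).
  have hstep : ∀ k : ℕ, 0 ≤ 2 * δ * a k - (a k ^ 2 - a (k + 1) ^ 2) ∧
      2 * δ * a k - (a k ^ 2 - a (k + 1) ^ 2) ≤ δ ^ 2 := by
    intro k
    simp only [ha]
    push_cast
    rcases le_total x (k * δ) with h | h
    · rw [min_eq_left h, min_eq_left (by linarith)]
      simp [sq_nonneg]
    · rw [min_eq_right h]
      rcases le_total x ((k + 1) * δ) with h' | h'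
      · rw [min_eq_left h']
        constructor <;> nlinarith [sq_nonneg (x - k * δ - δ)]
      · rw [min_eq_right h']
        constructor <;> nlinarith
  have htel : ∑ k ∈ Finset.range (n + 1), (a k ^ 2 - a (k + 1) ^ 2) = x ^ 2 := by
    rw [Finset.sum_range_sub']
    simp only [ha]
    push_cast
    rw [hM, min_eq_left hxM, zero_mul, min_eq_right hx0]
    ring
  rw [← htel, ← Finset.sum_sub_distrib, abs_of_nonneg (Finset.sum_nonneg fun k _ => (hstep k).1)]
  refine (Finset.sum_le_sum fun k _ => (hstep k).2).trans (le_of_eq ?_)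
  rw [Finset.sum_const, Finset.card_range, nsmul_eq_mul, hδ]
  push_cast
  field_simp

namespace DirichletForm

variable {X : Type u} [MeasurableSpace X] {μ : Measure X} (E : DirichletForm μ)

/-! ### Bounded functions in the domain -/

/-- `L²` limits of bounded sequences in `Dom ℰ` belong to `Dom ℰ`. -/
theorem exists_coe_eq_of_tendsto {u : ℕ → E.domain} {C : ℝ} (hu : ∀ n, ‖E.toDom (u n)‖ ≤ C)
    {w : Lp ℝ 2 μ} (hw : Tendsto (fun n => (u n : Lp ℝ 2 μ)) atTop (𝓝 w)) :
    ∃ z : E.domain, (z : Lp ℝ 2 μ) = w := by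
  -- Banach–Alaoglu through the Riesz isomorphism gives a weak limit z along an ultrafilter. Testing
  -- with the adjoint of the inclusion identifies z with w in L².
  have hc := WeakDual.isCompact_closedBall (𝕜 := ℝ) (E := E.DomSpace) 0 C
  let φ : ℕ → WeakDual ℝ E.DomSpace := fun n =>
    StrongDual.toWeakDual (InnerProductSpace.toDual ℝ E.DomSpace (E.toDom (u n)))
  obtain ⟨ψ, -, hψ⟩ := hc.ultrafilter_le_nhds ((hyperfilter ℕ).map φ) (by
    rw [Ultrafilter.coe_map, le_principal_iff]
    refine mem_map.2 (Eventually.of_forall fun n => ?_)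
    simpa [φ] using hu n)
  obtain ⟨z, hz⟩ := (InnerProductSpace.toDual ℝ E.DomSpace).surjective (WeakDual.toStrongDual ψ)
  refine ⟨E.ofDom z, ext_inner_right ℝ fun g => ?_⟩
  have hadj : ∀ v : E.DomSpace, inner ℝ (E.domIncl v) g
      = inner ℝ v (ContinuousLinearMap.adjoint E.domIncl g) := fun v =>
    (ContinuousLinearMap.adjoint_inner_right E.domIncl v g).symm
  have h1 : Tendsto (fun n => φ n (ContinuousLinearMap.adjoint E.domIncl g))
      (hyperfilter ℕ : Filter ℕ) (𝓝 (ψ (ContinuousLinearMap.adjoint E.domIncl g))) :=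
    ((WeakDual.eval_continuous (ContinuousLinearMap.adjoint E.domIncl g)).tendsto ψ).comp hψ
  have h2 : Tendsto (fun n => inner ℝ (u n : Lp ℝ 2 μ) g) (hyperfilter ℕ : Filter ℕ)
      (𝓝 (inner ℝ w g)) :=
    (hw.mono_left (Nat.hyperfilter_le_atTop)).inner tendsto_const_nhds
  have h3 : ψ (ContinuousLinearMap.adjoint E.domIncl g) = inner ℝ (E.domIncl z) g := by
    rw [hadj, ← InnerProductSpace.toDual_apply_apply (𝕜 := ℝ), hz]
    rfl
  rw [h3] at h1
  refine tendsto_nhds_unique h1 (h2.congr fun n => ?_)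
  exact hadj (E.toDom (u n))

theorem exists_contraction (u : E.domain) {c : ℝ} (hc : 0 ≤ c) :
    ∃ v : E.domain, (∀ᵐ x ∂μ, (v : Lp ℝ 2 μ) x = min (max ((u : Lp ℝ 2 μ) x) 0) c) ∧
      E.form v v ≤ E.form u u := by
  -- The rescaling by c⁻¹ needs c > 0, while the level c = 0 does occur as the first Riemann node.
  rcases hc.eq_or_lt with rfl | hc
  · refine ⟨0, ?_, by simpa using E.nonneg u⟩
    filter_upwards [Lp.coeFn_zero ℝ 2 μ] with x hx
    rw [min_eq_right (le_max_right _ _)]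
    exact hx
  obtain ⟨v, hv, hE⟩ := E.markov (c⁻¹ • u)
  refine ⟨c • v, ?_, ?_⟩
  · filter_upwards [hv, Lp.coeFn_smul c⁻¹ (u : Lp ℝ 2 μ), Lp.coeFn_smul c (v : Lp ℝ 2 μ)]
      with x h1 h2 h3
    have h2' : ((c⁻¹ • u : E.domain) : Lp ℝ 2 μ) x = c⁻¹ * (u : Lp ℝ 2 μ) x := h2
    have h3' : ((c • v : E.domain) : Lp ℝ 2 μ) x = c * (v : Lp ℝ 2 μ) x := h3
    rw [h3', h1, h2', mul_min_of_nonneg _ _ hc.le, mul_max_of_nonneg _ _ hc.le, ← mul_assoc,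
      mul_inv_cancel₀ hc.ne', one_mul, mul_zero, mul_one]
  · simp only [map_smul, LinearMap.smul_apply, smul_eq_mul] at hE ⊢
    calc c * (c * E.form v v) ≤ c * (c * (c⁻¹ * (c⁻¹ * E.form u u))) := by gcongr
      _ = E.form u u := by field_simp

/-- Use u² = 2∫₀^M (u - min(u,s)) ds. Each truncation has form norm at most that of u, so the
Riemann sums are bounded in Dom ℰ, and they converge to u² uniformly, hence in L². -/
theorem exists_sq_of_nonneg [IsFiniteMeasure μ] {u : E.domain} {M : ℝ} (hM : 0 ≤ M)
    (hu : ∀ᵐ x ∂μ, 0 ≤ (u : Lp ℝ 2 μ) x ∧ (u : Lp ℝ 2 μ) x ≤ M) :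
    ∃ v : E.domain, ∀ᵐ x ∂μ, (v : Lp ℝ 2 μ) x = (u : Lp ℝ 2 μ) x ^ 2 := by
  have hmem : MemLp (fun x => (u : Lp ℝ 2 μ) x ^ 2) 2 μ := by
    refine MemLp.of_bound ((Lp.aestronglyMeasurable _).pow 2) (M ^ 2) ?_
    filter_upwards [hu] with x hx
    rw [Real.norm_of_nonneg (sq_nonneg _)]
    exact pow_le_pow_left₀ hx.1 hx.2 2
  have hδ : ∀ n : ℕ, 0 ≤ M / ((n : ℝ) + 1) := fun n => by positivity
  choose c hc hcE using fun (n k : ℕ) =>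
    E.exists_contraction u (mul_nonneg (Nat.cast_nonneg k) (hδ n))
  let w : ℕ → E.domain := fun n =>
    ∑ k ∈ Finset.range (n + 1), (2 * (M / ((n : ℝ) + 1))) • (u - c n k)
  have hcnorm : ∀ n k, ‖E.toDom (c n k)‖ ≤ ‖E.toDom u‖ := by
    intro n k
    refine le_of_sq_le_sq ?_ (norm_nonneg _)
    rw [E.norm_toDom_sq, E.norm_toDom_sq]
    have h1 : ‖(c n k : Lp ℝ 2 μ)‖ ≤ ‖(u : Lp ℝ 2 μ)‖ := by
      refine Lp.norm_le_norm_of_ae_le ?_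
      filter_upwards [hc n k, hu] with x h1 h2
      have h3 : 0 ≤ min ((u : Lp ℝ 2 μ) x) (k * (M / (n + 1))) := le_min h2.1 (by positivity)
      rw [h1, max_eq_left h2.1, Real.norm_of_nonneg h2.1, Real.norm_of_nonneg h3]
      exact min_le_left _ _
    have := hcE n k
    gcongr
  have hbound : ∀ n, ‖E.toDom (w n)‖ ≤ 4 * M * ‖E.toDom u‖ := by
    intro n
    simp only [w, map_sum, map_smul, map_sub]
    refine (norm_sum_le _ _).trans ?_
    have h1 : ∀ k ∈ Finset.range (n + 1), ‖(2 * (M / ((n : ℝ) + 1))) • (E.toDom u - E.toDom (c n k))‖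
        ≤ 2 * (M / ((n : ℝ) + 1)) * (2 * ‖E.toDom u‖) := by
      intro k _
      have := hδ n
      rw [norm_smul, Real.norm_of_nonneg (by positivity)]
      gcongr
      have h2 := norm_sub_le (E.toDom u) (E.toDom (c n k))
      have h3 := hcnorm n k
      linarith
    refine (Finset.sum_le_sum h1).trans (le_of_eq ?_)
    rw [Finset.sum_const, Finset.card_range, nsmul_eq_mul]
    push_cast
    field_simp
    ring
  have hlim : Tendsto (fun n => (w n : Lp ℝ 2 μ)) atTop (𝓝 (hmem.toLp _)) := by
    rw [tendsto_iff_norm_sub_tendsto_zero]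
    have h0 : Tendsto (fun n : ℕ => (μ.real Set.univ) ^ ((2 : ℝ≥0∞).toReal)⁻¹ * (M ^ 2 / ((n : ℝ) + 1)))
        atTop (𝓝 ((μ.real Set.univ) ^ ((2 : ℝ≥0∞).toReal)⁻¹ * 0)) :=
      (tendsto_const_nhds.div_atTop
        (tendsto_atTop_add_const_right _ _ tendsto_natCast_atTop_atTop)).const_mul _
    rw [mul_zero] at h0
    refine squeeze_zero (fun n => norm_nonneg _) (fun n => ?_) h0
    refine Lp.norm_le_of_ae_bound (by positivity) ?_
    have hw : (w n : Lp ℝ 2 μ) = ∑ k ∈ Finset.range (n + 1),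
        (2 * (M / ((n : ℝ) + 1))) • ((u : Lp ℝ 2 μ) - (c n k : Lp ℝ 2 μ)) := by
      simp only [w, Submodule.coe_sum, Submodule.coe_smul, Submodule.coe_sub]
    have hk : ∀ᵐ x ∂μ, ∀ k : ℕ,
        ((2 * (M / ((n : ℝ) + 1))) • ((u : Lp ℝ 2 μ) - (c n k : Lp ℝ 2 μ)) : Lp ℝ 2 μ) x
          = 2 * (M / ((n : ℝ) + 1))
            * ((u : Lp ℝ 2 μ) x - min ((u : Lp ℝ 2 μ) x) (k * (M / ((n : ℝ) + 1)))) := by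
      refine ae_all_iff.2 fun k => ?_
      filter_upwards [Lp.coeFn_smul (2 * (M / ((n : ℝ) + 1)))
        ((u : Lp ℝ 2 μ) - (c n k : Lp ℝ 2 μ)), Lp.coeFn_sub (u : Lp ℝ 2 μ) (c n k : Lp ℝ 2 μ),
        hc n k, hu] with x h1 h2 h3 h4
      rw [h1, Pi.smul_apply, h2, Pi.sub_apply, h3, max_eq_left h4.1, smul_eq_mul]
    filter_upwards [Lp.coeFn_sub (w n : Lp ℝ 2 μ) (hmem.toLp _), hmem.coeFn_toLp, hk, hu,
      Lp.coeFn_finsetSum (μ := μ) (p := 2) (Finset.range (n + 1)) (fun k =>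
        (2 * (M / ((n : ℝ) + 1))) • ((u : Lp ℝ 2 μ) - (c n k : Lp ℝ 2 μ)))] with x h1 h2 h3 h4 h5
    rw [h1, Pi.sub_apply, h2, hw, h5, Finset.sum_apply, Real.norm_eq_abs]
    simp only [h3]
    exact abs_sum_sub_min_sub_sq_le h4.1 h4.2 n
  obtain ⟨z, hz⟩ := E.exists_coe_eq_of_tendsto hbound hlim
  refine ⟨z, ?_⟩
  rw [hz]
  exact hmem.coeFn_toLp

/-- `u` is essentially bounded. -/
def IsBounded (u : E.domain) : Prop := ∃ M : ℝ, ∀ᵐ x ∂μ, |(u : Lp ℝ 2 μ) x| ≤ M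

variable {E}

/-- u² = (u⁺)² + (u⁻)², and both parts fall under the nonnegative case. -/
theorem IsBounded.exists_sq [IsFiniteMeasure μ] {u : E.domain} (hu : E.IsBounded u) :
    ∃ v : E.domain, ∀ᵐ x ∂μ, (v : Lp ℝ 2 μ) x = (u : Lp ℝ 2 μ) x ^ 2 := by
  obtain ⟨M, hM⟩ := hu
  obtain ⟨p, hp, -⟩ := E.exists_contraction u (abs_nonneg M)
  obtain ⟨q, hq, -⟩ := E.exists_contraction (-u) (abs_nonneg M)
  have hmem : ∀ a : ℝ, 0 ≤ min (max a 0) |M| ∧ min (max a 0) |M| ≤ |M| := fun a =>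
    ⟨le_min (le_max_right _ _) (abs_nonneg _), min_le_right _ _⟩
  obtain ⟨p2, hp2⟩ := E.exists_sq_of_nonneg (abs_nonneg M)
    (show ∀ᵐ x ∂μ, 0 ≤ (p : Lp ℝ 2 μ) x ∧ (p : Lp ℝ 2 μ) x ≤ |M| by
      filter_upwards [hp] with x hx; rw [hx]; exact hmem _)
  obtain ⟨q2, hq2⟩ := E.exists_sq_of_nonneg (abs_nonneg M)
    (show ∀ᵐ x ∂μ, 0 ≤ (q : Lp ℝ 2 μ) x ∧ (q : Lp ℝ 2 μ) x ≤ |M| by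
      filter_upwards [hq] with x hx; rw [hx]; exact hmem _)
  refine ⟨p2 + q2, ?_⟩
  filter_upwards [hM, hp, hq, hp2, hq2, Lp.coeFn_add (p2 : Lp ℝ 2 μ) (q2 : Lp ℝ 2 μ),
    Lp.coeFn_neg (u : Lp ℝ 2 μ)] with x h1 h2 h3 h4 h5 h6 h7
  have h7' : ((-u : E.domain) : Lp ℝ 2 μ) x = -(u : Lp ℝ 2 μ) x := h7
  have h8 := h1.trans (le_abs_self M)
  rw [Submodule.coe_add, h6, Pi.add_apply, h4, h5, h2, h3, h7']
  rcases le_total 0 ((u : Lp ℝ 2 μ) x) with h | h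
  · rw [max_eq_left h, max_eq_right (by linarith), min_eq_left (by rwa [abs_of_nonneg h] at h8),
      min_eq_left (abs_nonneg _)]
    ring
  · rw [max_eq_right h, max_eq_left (by linarith), min_eq_left (abs_nonneg _),
      min_eq_left (by rwa [abs_of_nonpos h] at h8)]
    ring

theorem IsBounded.add {u v : E.domain} (hu : E.IsBounded u) (hv : E.IsBounded v) :
    E.IsBounded (u + v) := by
  obtain ⟨M, hM⟩ := hu
  obtain ⟨N, hN⟩ := hv
  refine ⟨M + N, ?_⟩
  filter_upwards [hM, hN, Lp.coeFn_add (u : Lp ℝ 2 μ) (v : Lp ℝ 2 μ)] with x h1 h2 h3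
  rw [Submodule.coe_add, h3]
  exact (abs_add_le _ _).trans (add_le_add h1 h2)

/-- Bounded functions in `Dom ℰ` form an algebra. -/
theorem IsBounded.exists_mul [IsFiniteMeasure μ] {u v : E.domain} (hu : E.IsBounded u)
    (hv : E.IsBounded v) :
    ∃ w : E.domain, ∀ᵐ x ∂μ, (w : Lp ℝ 2 μ) x = (u : Lp ℝ 2 μ) x * (v : Lp ℝ 2 μ) x := by
  obtain ⟨a, ha⟩ := hu.exists_sq
  obtain ⟨b, hb⟩ := hv.exists_sq
  obtain ⟨c, hc⟩ := (hu.add hv).exists_sq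
  refine ⟨(1 / 2 : ℝ) • (c - a - b), ?_⟩
  filter_upwards [ha, hb, hc, Lp.coeFn_add (u : Lp ℝ 2 μ) (v : Lp ℝ 2 μ),
    Lp.coeFn_smul (1 / 2 : ℝ) (c - a - b : Lp ℝ 2 μ),
    Lp.coeFn_sub (c - a : Lp ℝ 2 μ) (b : Lp ℝ 2 μ),
    Lp.coeFn_sub (c : Lp ℝ 2 μ) (a : Lp ℝ 2 μ)] with x h1 h2 h3 h4 h5 h6 h7
  rw [Submodule.coe_smul, Submodule.coe_sub, Submodule.coe_sub, h5, Pi.smul_apply, h6, Pi.sub_apply,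
    h7, Pi.sub_apply, h1, h2, h3, Submodule.coe_add, h4, Pi.add_apply, smul_eq_mul]
  ring

theorem isBounded_approx (α : Set.Ioi (0 : ℝ)) {f : Lp ℝ 2 μ} (hf0 : ∀ᵐ x ∂μ, 0 ≤ f x)
    (hf1 : ∀ᵐ x ∂μ, f x ≤ 1) : E.IsBounded (E.approx α f) := by
  refine ⟨1, ?_⟩
  filter_upwards [E.approx_mem_Icc α hf0 hf1] with x hx
  rw [abs_of_nonneg hx.1]
  exact hx.2

end DirichletForm

/-! ### Compact spaces: the constant function and the total mass of Γ -/

namespace DirichletForm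

variable {X : Type u} [MetricSpace X] [CompactSpace X] [MeasurableSpace X] {μ : Measure X}
  {E : DirichletForm μ}

/-- A core function uniformly within 1/2 of the constant 1 exceeds 1/2 everywhere; truncating it at
1/2 and doubling gives 1. -/
theorem IsRegular.exists_one (hE : E.IsRegular) :
    ∃ v : E.domain, ∀ᵐ x ∂μ, (v : Lp ℝ 2 μ) x = 1 := by
  obtain ⟨v, φ, ⟨-, -, hv⟩, hφ⟩ := hE.2 (fun _ => 1) continuous_const
    (HasCompactSupport.of_compactSpace _) (1 / 2) (by norm_num)
  obtain ⟨w, hw, -⟩ := E.exists_contraction v (show (0 : ℝ) ≤ 1 / 2 by norm_num)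
  refine ⟨(2 : ℝ) • w, ?_⟩
  filter_upwards [hv, hw, Lp.coeFn_smul (2 : ℝ) (w : Lp ℝ 2 μ)] with x h1 h2 h3
  have h4 := (abs_lt.1 (hφ x)).2
  rw [Submodule.coe_smul, h3, Pi.smul_apply, h2, h1, max_eq_left (by linarith),
    min_eq_right (by linarith)]
  norm_num

theorem IsStrictlyLocal.form_one (hE : E.IsStrictlyLocal) (u : E.domain) {v : E.domain}
    (hv : ∀ᵐ x ∂μ, (v : Lp ℝ 2 μ) x = 1) : E.form u v = 0 :=
  hE u v Set.univ Set.univ Set.univ 1 isCompact_univ isClosed_univ isCompact_univ isClosed_univ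
    isOpen_univ (Set.subset_univ _) (Eventually.of_forall fun x hx => absurd (Set.mem_univ x) hx)
    (Eventually.of_forall fun x hx => absurd (Set.mem_univ x) hx)
    (by filter_upwards [hv] with x hx _ using hx)

theorem IsCoreFunction.isBounded {u : E.domain} {φ : X → ℝ} (h : E.IsCoreFunction u φ) :
    E.IsBounded u := by
  obtain ⟨M, hM⟩ := isCompact_univ.exists_bound_of_continuousOn h.1.continuousOn
  refine ⟨M, ?_⟩
  filter_upwards [h.2.2] with x hx
  rw [hx]
  exact hM x (Set.mem_univ x)

end DirichletForm

namespace CarreDuChamp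

section Local

variable {X : Type u} [MetricSpace X] [CompactSpace X] [MeasurableSpace X] {μ : Measure X}
  [IsFiniteMeasure μ] {E : DirichletForm μ} (Γ : CarreDuChamp E)

/-- Take h = 1 in the identity defining Γ; strict locality kills the term ℰ(fg, 1). -/
theorem integral_gamma_of_isBounded (hr : E.IsRegular) (hl : E.IsStrictlyLocal) {f g : E.domain}
    (hf : E.IsBounded f) (hg : E.IsBounded g) : ∫ x, Γ.gamma f g x ∂μ = E.form f g := by
  obtain ⟨e, he⟩ := hr.exists_one
  obtain ⟨fg, hfg⟩ := hf.exists_mul hg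
  have h := Γ.integral_eq f g e fg f g hf hg
    ⟨1, by filter_upwards [he] with x hx; rw [hx, abs_one]⟩ hfg
    (by filter_upwards [he] with x hx; rw [hx, mul_one])
    (by filter_upwards [he] with x hx; rw [hx, mul_one])
  rw [hl.form_one fg he, E.symm g f] at h
  have h1 : ∫ x, (e : Lp ℝ 2 μ) x * Γ.gamma f g x ∂μ = ∫ x, Γ.gamma f g x ∂μ :=
    integral_congr_ae (by filter_upwards [he] with x hx; rw [hx, one_mul])
  linarith

/-- Both sides are continuous in g for the form norm, and core functions are bounded and dense. An
unbounded g must be allowed because a codifferential is tested on all of Dom ℰ. -/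
theorem integral_gamma_eq (hr : E.IsRegular) (hl : E.IsStrictlyLocal) {f : E.domain}
    (hf : E.IsBounded f) (g : E.domain) : ∫ x, Γ.gamma f g x ∂μ = E.form f g := by
  obtain ⟨K, hK⟩ := Γ.exists_integral_gamma_le
  set C := √(∫ x, Γ.gamma f f x ∂μ) * K + √(E.form f f) with hC
  have hC0 : 0 ≤ C := by positivity
  have hkey : ∀ v : E.domain, |∫ x, Γ.gamma f v x ∂μ - E.form f v| ≤ C * ‖E.toDom v‖ := by
    intro v
    have h1 : |∫ x, Γ.gamma f v x ∂μ| ≤ √(∫ x, Γ.gamma f f x ∂μ) * (K * ‖E.toDom v‖) := by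
      refine ((abs_integral_le_norm _).trans
        (norm_le_sqrt_mul_sqrt Γ.symm Γ.nonneg f v)).trans ?_
      gcongr
      exact hK v
    have h2 : |E.form f v| ≤ √(E.form f f) * ‖E.toDom v‖ := by
      refine (Real.abs_le_sqrt (E.form_sq_le f v)).trans ?_
      rw [Real.sqrt_mul (E.nonneg f)]
      gcongr
      refine Real.sqrt_le_iff.2 ⟨norm_nonneg _, ?_⟩
      rw [E.norm_toDom_sq]
      linarith [sq_nonneg ‖(v : Lp ℝ 2 μ)‖]
    refine (abs_sub _ _).trans ?_
    rw [hC]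
    linarith
  rw [← sub_eq_zero, ← abs_eq_zero]
  refine le_antisymm (le_of_forall_pos_le_add fun ε hε => ?_) (abs_nonneg _)
  obtain ⟨v, φ, hvφ, hv⟩ := hr.1 g ((ε / (C + 1)) ^ 2) (by positivity)
  have h1 : ‖E.toDom (g - v)‖ ≤ ε / (C + 1) := by
    refine le_of_sq_le_sq ?_ (by positivity)
    rw [E.norm_toDom_sq, add_comm]
    exact hv.le
  have h2 := hkey (g - v)
  have h3 : ∫ x, Γ.gamma f (g - v) x ∂μ = ∫ x, Γ.gamma f g x ∂μ - ∫ x, Γ.gamma f v x ∂μ := by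
    rw [map_sub, ← integral_sub (L1.integrable_coeFn _) (L1.integrable_coeFn _)]
    exact integral_congr_ae (Lp.coeFn_sub _ _)
  rw [h3, Γ.integral_gamma_of_isBounded hr hl hf hvφ.isBounded, map_sub, sub_sub_sub_cancel_right]
    at h2
  rw [zero_add]
  calc _ ≤ C * ‖E.toDom (g - v)‖ := h2
    _ ≤ (C + 1) * (ε / (C + 1)) := by gcongr; linarith
    _ = ε := by field_simp

end Local

variable {X : Type u} [MeasurableSpace X] {μ : Measure X} {E : DirichletForm μ}
  (Γ : CarreDuChamp E)

/-! ### Fibre norm and codifferential of exact forms -/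

theorem fiberInner_tmul_one (f g : E.domain) :
    Γ.fiberInner (Γ.tmul f 1) (Γ.tmul g 1) = Γ.gamma f g := by
  rw [fiberInner_tmul]
  apply Lp.ext
  filter_upwards [boundedMeasurable.mulL1_coe (Γ.gamma f g) (1 * 1)] with x hx
  rw [hx, mul_one]
  exact one_mul _

/-- The difference at ω and ω₀ is the pairing of ω - ω₀ with ω + ω₀, bounded by Cauchy–Schwarz.
Continuity ensures that the extension defining the fibre norm has the original values on simple
forms. -/
theorem continuous_fiberInner_self : Continuous fun ω : Γ.SimpleForm => Γ.fiberInner ω ω := by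
  rw [continuous_iff_continuousAt]
  intro ω₀
  rw [ContinuousAt, tendsto_iff_norm_sub_tendsto_zero]
  have h0 : Tendsto (fun ω : Γ.SimpleForm => ‖ω - ω₀‖ * ‖ω + ω₀‖) (𝓝 ω₀) (𝓝 0) := by
    have : Continuous fun ω : Γ.SimpleForm => ‖ω - ω₀‖ * ‖ω + ω₀‖ := by fun_prop
    have h := this.tendsto ω₀
    simpa using h
  refine squeeze_zero (fun _ => norm_nonneg _) (fun ω => ?_) h0
  have h1 : Γ.fiberInner ω ω - Γ.fiberInner ω₀ ω₀ = Γ.fiberInner (ω - ω₀) (ω + ω₀) := by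
    simp only [map_sub, map_add, LinearMap.sub_apply, Γ.fiberInner_symm ω₀ ω]
    abel
  rw [h1]
  exact norm_le_sqrt_mul_sqrt Γ.fiberInner_symm Γ.fiberInner_nonneg _ _

theorem fiberNormSq_exteriorDeriv (f : E.domain) :
    Γ.fiberNormSq (Γ.exteriorDeriv f) = Γ.gamma f f := by
  rw [fiberNormSq, exteriorDeriv, IsDenseInducing.extend_eq _ Γ.continuous_fiberInner_self,
    fiberInner_tmul_one]

theorem inner_exteriorDeriv (f g : E.domain) :
    inner ℝ (Γ.exteriorDeriv f) (Γ.exteriorDeriv g) = ∫ x, Γ.gamma f g x ∂μ := by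
  rw [exteriorDeriv, exteriorDeriv, UniformSpace.Completion.inner_coe, ← fiberInner_tmul_one]
  rfl

/-- An exact form with bounded fibre norm bounds the variation from below. -/
theorem inner_le_variation {f g : Lp ℝ 2 μ} {w : E.domain} {c : ℝ} (hc : 0 < c)
    (hw : ∀ φ : E.domain, ∫ x, Γ.gamma w φ x ∂μ = inner ℝ g (φ : Lp ℝ 2 μ))
    (hb : ∀ᵐ x ∂μ, Γ.sqrtGamma w x ≤ c) :
    ENNReal.ofReal (inner ℝ f g / c) ≤ Γ.variation f := by
  -- By `hw`, g = ∂*∂w; dividing by c normalizes the fibre norm to at most 1.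
  have hcod : Γ.IsCodifferential (Γ.exteriorDeriv (c⁻¹ • w)) (c⁻¹ • g) := by
    intro φ
    rw [inner_exteriorDeriv, real_inner_smul_left, ← hw, ← integral_const_mul, map_smul,
      LinearMap.smul_apply]
    exact integral_congr_ae (Lp.coeFn_smul _ _)
  have hnorm : ∀ᵐ x ∂μ, Γ.fiberNorm (Γ.exteriorDeriv (c⁻¹ • w)) x ≤ 1 := by
    filter_upwards [hb, Γ.coeFn_sqrtGamma (c⁻¹ • w),
      Lp.coeFn_smul c⁻¹ (Γ.sqrtGamma w)] with x h1 h2 h3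
    rw [Γ.sqrtGamma_smul (by positivity), h3, Pi.smul_apply, smul_eq_mul] at h2
    rw [fiberNorm, fiberNormSq_exteriorDeriv, ← h2, inv_mul_le_iff₀ hc, mul_one]
    exact h1
  have h := le_iSup₂_of_le (f := fun (η : Γ.OneForm) (g : Lp ℝ 2 μ) =>
    ⨆ (_ : Γ.IsCodifferential η g) (_ : ∀ᵐ x ∂μ, Γ.fiberNorm η x ≤ 1),
      ENNReal.ofReal (inner ℝ f g)) (Γ.exteriorDeriv (c⁻¹ • w)) (c⁻¹ • g)
    (le_iSup₂_of_le hcod hnorm le_rfl)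
  rw [real_inner_smul_right, inv_mul_eq_div] at h
  exact h

end CarreDuChamp

namespace DirichletForm

variable {X : Type u} [MeasurableSpace X] {μ : Measure X} [IsFiniteMeasure μ] (E : DirichletForm μ)

/-- By symmetry ∫J_α h = ⟪h, J_α 1⟫, and J_α 1 ≤ 1. -/
theorem integral_approx_le (α : Set.Ioi (0 : ℝ)) {h : Lp ℝ 2 μ} (hh : ∀ᵐ x ∂μ, 0 ≤ h x) :
    ∫ x, (E.approx α h : Lp ℝ 2 μ) x ∂μ ≤ ∫ x, h x ∂μ := by
  have h1 : ∀ᵐ x ∂μ, Lp.const 2 μ (1 : ℝ) x = 1 := Lp.coeFn_const 2 μ (1 : ℝ)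
  have h2 := E.approx_mem_Icc α (f := Lp.const 2 μ (1 : ℝ))
    (by filter_upwards [h1] with x hx; rw [hx]; exact zero_le_one)
    (by filter_upwards [h1] with x hx; rw [hx])
  have h3 : ∀ g : Lp ℝ 2 μ, inner ℝ g (Lp.const 2 μ (1 : ℝ)) = ∫ x, g x ∂μ := by
    intro g
    rw [inner_eq_integral_mul]
    refine integral_congr_ae ?_
    filter_upwards [h1] with x hx
    rw [hx, mul_one]
  rw [← h3, ← h3, inner_approx_comm]
  refine inner_le_inner_of_ae_le hh ?_
  filter_upwards [h1, h2] with x hx hx2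
  rw [hx]
  exact hx2.2

end DirichletForm

namespace CarreDuChamp

variable {X : Type u} [MeasurableSpace X] {μ : Measure X} [IsFiniteMeasure μ]
  {E : DirichletForm μ} (Γ : CarreDuChamp E)

/-! ### The gradient bound -/

/-- `4 α`. -/
def fourMul (α : Set.Ioi (0 : ℝ)) : Set.Ioi (0 : ℝ) :=
  ⟨4 * α.1, Set.mem_Ioi.2 (mul_pos four_pos α.2)⟩

/-- With u = J_{4α} f and v = J_α h, 2∫vΓ(u) = 2ℰ(uv,u) - ℰ(u²,v). The resolvent equations turn this
into α∫(v(8fu - 7u²) - hu²), and 8fu - 7u² ≤ 4 pointwise. -/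
theorem integral_approx_mul_gamma_le (α : Set.Ioi (0 : ℝ)) {f h : Lp ℝ 2 μ}
    (hf0 : ∀ᵐ x ∂μ, 0 ≤ f x) (hf1 : ∀ᵐ x ∂μ, f x ≤ 1) (hh0 : ∀ᵐ x ∂μ, 0 ≤ h x)
    (hh1 : ∀ᵐ x ∂μ, h x ≤ 1) :
    ∫ x, (E.approx α h : Lp ℝ 2 μ) x
        * Γ.gamma (E.approx (fourMul α) f) (E.approx (fourMul α) f) x ∂μ
      ≤ 2 * α.1 * ∫ x, h x ∂μ := by
  have hα : (0 : ℝ) < α.1 := α.2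
  have hub := E.approx_mem_Icc (fourMul α) hf0 hf1
  have hvb := E.approx_mem_Icc α hh0 hh1
  have hu := DirichletForm.isBounded_approx (E := E) (fourMul α) hf0 hf1
  have hv := DirichletForm.isBounded_approx (E := E) α hh0 hh1
  have hvint := E.integral_approx_le α hh0
  have hEu := E.form_approx (fourMul α) f
  have hEv := E.form_approx α h
  set u := E.approx (fourMul α) f
  set v := E.approx α h
  obtain ⟨uu, huu⟩ := hu.exists_mul hu
  obtain ⟨uv, huv⟩ := hu.exists_mul hv
  have key := Γ.integral_eq u u v uu uv uv hu hu hv huu huv huv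
  rw [E.symm uv u, E.symm uu v, hEu, hEv, inner_eq_integral_mul, inner_eq_integral_mul,
    ← integral_const_mul, ← integral_const_mul, ← integral_const_mul, ← integral_add,
    ← integral_sub] at key
  rotate_left
  · exact ((integrable_mul_L2 _ _).const_mul _).add ((integrable_mul_L2 _ _).const_mul _)
  · exact (integrable_mul_L2 _ _).const_mul _
  · exact (integrable_mul_L2 _ _).const_mul _
  · exact (integrable_mul_L2 _ _).const_mul _
  have hvi : Integrable (fun x => (v : Lp ℝ 2 μ) x) μ :=
    (Lp.memLp (v : Lp ℝ 2 μ)).integrable one_le_two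
  have hle : 2 * ∫ x, (v : Lp ℝ 2 μ) x * Γ.gamma u u x ∂μ
      ≤ ∫ x, 4 * α.1 * (v : Lp ℝ 2 μ) x ∂μ := by
    rw [← integral_const_mul, key]
    refine integral_mono_ae
      ((((integrable_mul_L2 _ _).const_mul _).add ((integrable_mul_L2 _ _).const_mul _)).sub
        ((integrable_mul_L2 _ _).const_mul _)) (hvi.const_mul _) ?_
    filter_upwards [hub, hvb, hf0, hf1, hh0, huu, huv, Lp.coeFn_sub f (u : Lp ℝ 2 μ),
      Lp.coeFn_sub h (v : Lp ℝ 2 μ)] with x h1 h2 h3 h4 h5 h6 h7 h8 h9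
    rw [h6, h7, h8, h9, Pi.sub_apply, Pi.sub_apply]
    change 4 * α.1 * _ + 4 * α.1 * _ - _ ≤ _
    generalize (u : Lp ℝ 2 μ) x = a at *
    generalize (v : Lp ℝ 2 μ) x = b at *
    generalize f x = c at *
    generalize h x = d at *
    -- Since c ≤ 1 it suffices that 7(4 - 8a + 7a²) = (7a - 4)² + 12.
    have e1 : 0 ≤ 4 - 8 * c * a + 7 * a ^ 2 := by
      have : c * a ≤ 1 * a := by gcongr; exact h1.1
      nlinarith [sq_nonneg (7 * a - 4)]
    have e2 := mul_nonneg (mul_nonneg hα.le h2.1) e1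
    have e3 := mul_nonneg hα.le (mul_nonneg h5 (sq_nonneg a))
    linarith
  rw [integral_const_mul] at hle
  have := mul_le_mul_of_nonneg_left hvint hα.le
  linarith

variable {Γ} in
/-- The gradient bound `‖√Γ(α (α - Δ)⁻¹ 4α (4α - Δ)⁻¹ f)‖_∞ ≤ 2 C₁ √α` for `0 ≤ f ≤ 1`. -/
theorem WeakBakryEmery.sqrtGamma_approx_approx_le {C₁ : ℝ} (hC₁ : 0 ≤ C₁)
    (hΓ : Γ.WeakBakryEmery C₁ 0) (α : Set.Ioi (0 : ℝ)) {f : Lp ℝ 2 μ} (hf0 : ∀ᵐ x ∂μ, 0 ≤ f x)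
    (hf1 : ∀ᵐ x ∂μ, f x ≤ 1) :
    ∀ᵐ x ∂μ, Γ.sqrtGamma (E.approx α (E.approx (fourMul α) f : Lp ℝ 2 μ)) x
      ≤ 2 * C₁ * √α.1 := by
  have hα : (0 : ℝ) < α.1 := α.2
  -- By duality, test against h = 1_S. The resolvent estimate moves J_α to v = J_α h, and
  -- Cauchy–Schwarz with weight v uses ∫v ≤ μ(S) and ∫vΓ(u) ≤ 2αμ(S).
  refine ae_le_of_forall_setIntegral_le
    ((Lp.memLp (Γ.sqrtGamma _)).integrable one_le_two) (integrable_const _) fun S hS hSμ => ?_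
  set h : Lp ℝ 2 μ := indicatorConstLp 2 hS hSμ.ne 1
  have hh : ∀ᵐ x ∂μ, 0 ≤ h x ∧ h x ≤ 1 := by
    filter_upwards [indicatorConstLp_coeFn (p := 2) (hs := hS) (hμs := hSμ.ne) (c := (1 : ℝ))]
      with x hx
    rw [hx]
    exact ⟨Set.indicator_nonneg (fun _ _ => zero_le_one) x,
      Set.indicator_le_self' (fun _ _ => zero_le_one) x⟩
  have hh0 := hh.mono fun _ hx => hx.1
  have hh1 := hh.mono fun _ hx => hx.2
  have hhint : ∫ x, h x ∂μ = μ.real S := by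
    have h1 := integral_indicatorConstLp (p := 2) hS hSμ.ne (1 : ℝ)
    rw [smul_eq_mul, mul_one] at h1
    exact h1
  rw [← L2.inner_indicatorConstLp_one hS hSμ.ne]
  refine (hΓ.inner_sqrtGamma_approx_le α hh0 _).trans ?_
  have hgam := Γ.integral_approx_mul_gamma_le α hf0 hf1 hh0 hh1
  have hvb := E.approx_mem_Icc α hh0 hh1
  have hvint := E.integral_approx_le α hh0
  set u := E.approx (fourMul α) f
  set v := E.approx α h
  rw [hhint] at hgam hvint
  have hvi : Integrable (fun x => (v : Lp ℝ 2 μ) x) μ :=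
    (Lp.memLp (v : Lp ℝ 2 μ)).integrable one_le_two
  have hvg : Integrable (fun x => (v : Lp ℝ 2 μ) x * Γ.gamma u u x) μ := by
    refine (L1.integrable_coeFn (Γ.gamma u u)).bdd_mul (c := 1) (Lp.aestronglyMeasurable _) ?_
    filter_upwards [hvb] with x hx
    rw [Real.norm_of_nonneg hx.1]
    exact hx.2
  have hv0 : ∀ᵐ x ∂μ, 0 ≤ (v : Lp ℝ 2 μ) x := hvb.mono fun _ hx => hx.1
  have hvg0 : ∀ᵐ x ∂μ, 0 ≤ (v : Lp ℝ 2 μ) x * Γ.gamma u u x := by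
    filter_upwards [hv0, Γ.nonneg u] with x h1 h2 using mul_nonneg h1 h2
  have hcs := (integral_sqrt_mul_sqrt_le hv0 hvg0 (memLp_sqrt_of_integrable hvi hv0)
    (memLp_sqrt_of_integrable hvg hvg0)).2
  have heq : ∫ x, √((v : Lp ℝ 2 μ) x) * √((v : Lp ℝ 2 μ) x * Γ.gamma u u x) ∂μ
      = inner ℝ (v : Lp ℝ 2 μ) (Γ.sqrtGamma u) := by
    rw [inner_eq_integral_mul]
    refine integral_congr_ae ?_
    filter_upwards [hv0, Γ.coeFn_sqrtGamma u] with x h1 h2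
    rw [h2, Real.sqrt_mul h1, ← mul_assoc, Real.mul_self_sqrt h1]
  rw [heq] at hcs
  have hS0 : 0 ≤ μ.real S := measureReal_nonneg
  have hfin : inner ℝ (v : Lp ℝ 2 μ) (Γ.sqrtGamma u) ≤ 2 * √α.1 * μ.real S := by
    refine hcs.trans ?_
    calc _ ≤ √(μ.real S) * √(2 * α.1 * μ.real S) :=
          mul_le_mul (Real.sqrt_le_sqrt hvint) (Real.sqrt_le_sqrt hgam) (Real.sqrt_nonneg _)
            (Real.sqrt_nonneg _)
      -- The factor √2 is relaxed to 2.
      _ ≤ √(μ.real S) * √(2 ^ 2 * (α.1 * μ.real S)) := by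
          gcongr √(μ.real S) * √?_
          have : 0 ≤ α.1 * μ.real S := by positivity
          linarith
      _ = 2 * √α.1 * μ.real S := by
          rw [Real.sqrt_mul (by positivity), Real.sqrt_sq zero_le_two, Real.sqrt_mul hα.le]
          linear_combination (2 * √α.1) * Real.mul_self_sqrt hS0
  rw [setIntegral_const, smul_eq_mul]
  have := mul_le_mul_of_nonneg_left hfin hC₁
  linarith

/-! ### Perimeter and the resolvent -/

variable [MetricSpace X] [CompactSpace X]

/-- `4 ^ n α`. -/
def fourPowMul (n : ℕ) (α : Set.Ioi (0 : ℝ)) : Set.Ioi (0 : ℝ) :=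
  ⟨4 ^ n * α.1, Set.mem_Ioi.2 (mul_pos (by positivity) α.2)⟩

section Variation

variable {Γ} {C₁ : ℝ} {f : Lp ℝ 2 μ}

/-- For w = J_α J_{4α} f the normalized form ∂w is a competitor for Var f, with ∂*∂w = α(J_{4α} f -
w). The resolvent identity gives J_{4α} f - J_α f = (3/4)(J_{4α} f - w); the factor 3/4 is dropped
at the end. -/
theorem WeakBakryEmery.inner_approx_sub_le (hC₁ : 0 < C₁) (hr : E.IsRegular)
    (hl : E.IsStrictlyLocal) (hΓ : Γ.WeakBakryEmery C₁ 0) (α : Set.Ioi (0 : ℝ))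
    (hf0 : ∀ᵐ x ∂μ, 0 ≤ f x) (hf1 : ∀ᵐ x ∂μ, f x ≤ 1) (hfin : Γ.variation f < ∞) :
    inner ℝ f (E.approxL (fourMul α) f) - inner ℝ f (E.approxL α f)
      ≤ 2 * C₁ * (Γ.variation f).toReal / √α.1 := by
  have hα : (0 : ℝ) < α.1 := α.2
  have hub := E.approx_mem_Icc (fourMul α) hf0 hf1
  set u := E.approx (fourMul α) f with hu
  have hwb := DirichletForm.isBounded_approx (E := E) α (hub.mono fun _ h => h.1)
    (hub.mono fun _ h => h.2)
  have hgrad := hΓ.sqrtGamma_approx_approx_le hC₁.le α hf0 hf1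
  set w := E.approx α (u : Lp ℝ 2 μ) with hw
  have hc : 0 < 2 * C₁ * √α.1 := by positivity
  have h1 := Γ.inner_le_variation (f := f) (g := α.1 • ((u : Lp ℝ 2 μ) - (w : Lp ℝ 2 μ))) hc
    (fun φ => by rw [Γ.integral_gamma_eq hr hl hwb, E.form_approx, real_inner_smul_left]) hgrad
  rw [ENNReal.ofReal_le_iff_le_toReal hfin.ne, div_le_iff₀ hc, real_inner_smul_right] at h1
  have h2 : (E.approx α f : Lp ℝ 2 μ)
      = (1 / 4 : ℝ) • (u : Lp ℝ 2 μ) + (3 / 4 : ℝ) • (w : Lp ℝ 2 μ) := by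
    rw [E.approx_eq α (fourMul α) f, Submodule.coe_add, Submodule.coe_smul, Submodule.coe_smul]
    have h3 : α.1 / (fourMul α).1 = 1 / 4 := by
      change α.1 / (4 * α.1) = 1 / 4
      field_simp
    rw [h3]
    norm_num
    rfl
  rw [E.approxL_apply, E.approxL_apply, h2, ← hu, inner_add_right, real_inner_smul_right,
    real_inner_smul_right]
  rw [inner_sub_right] at h1
  set P := (Γ.variation f).toReal
  have hP : 0 ≤ P := ENNReal.toReal_nonneg
  rw [le_div_iff₀ (Real.sqrt_pos.2 hα)]
  have h4 : √α.1 * √α.1 = α.1 := Real.mul_self_sqrt hα.le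
  have h5 : √α.1 * ((inner ℝ f (u : Lp ℝ 2 μ) - inner ℝ f (w : Lp ℝ 2 μ)) * √α.1)
      ≤ √α.1 * (2 * C₁ * P) := by
    calc _ = α.1 * (inner ℝ f (u : Lp ℝ 2 μ) - inner ℝ f (w : Lp ℝ 2 μ)) := by
          linear_combination (inner ℝ f (u : Lp ℝ 2 μ) - inner ℝ f (w : Lp ℝ 2 μ)) * h4
      _ ≤ _ := h1
      _ = _ := by ring
  have h6 := le_of_mul_le_mul_left h5 (Real.sqrt_pos.2 hα)
  have h7 : 0 ≤ C₁ * P := by positivity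
  nlinarith

/-- Telescope along 4ⁿα, where J_{4ⁿα} f → f. The n-th increment is at most K/2ⁿ, so the total is at
most 2K. -/
theorem WeakBakryEmery.inner_self_sub_le (hC₁ : 0 < C₁) (hr : E.IsRegular)
    (hl : E.IsStrictlyLocal) (hΓ : Γ.WeakBakryEmery C₁ 0) (α : Set.Ioi (0 : ℝ))
    (hf0 : ∀ᵐ x ∂μ, 0 ≤ f x) (hf1 : ∀ᵐ x ∂μ, f x ≤ 1) (hfin : Γ.variation f < ∞) :
    inner ℝ f f - inner ℝ f (E.approxL α f)
      ≤ 4 * C₁ * (Γ.variation f).toReal / √α.1 := by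
  have hα : (0 : ℝ) < α.1 := α.2
  set K := 2 * C₁ * (Γ.variation f).toReal / √α.1 with hK
  have hP : 0 ≤ (Γ.variation f).toReal := ENNReal.toReal_nonneg
  have hK0 : 0 ≤ K := by positivity
  have hstep : ∀ n : ℕ, inner ℝ f (E.approxL (fourPowMul n α) f) - inner ℝ f (E.approxL α f)
      ≤ 2 * K * (1 - (1 / 2) ^ n) := by
    intro n
    induction n with
    | zero =>
      have : fourPowMul 0 α = α := Subtype.ext (by simp [fourPowMul])
      rw [this]; simp
    | succ n ih =>
      have h1 := hΓ.inner_approx_sub_le hC₁ hr hl (fourPowMul n α) hf0 hf1 hfin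
      have h2 : fourMul (fourPowMul n α) = fourPowMul (n + 1) α :=
        Subtype.ext (by simp only [fourMul, fourPowMul]; ring)
      have h3 : √(fourPowMul n α).1 = 2 ^ n * √α.1 := by
        simp only [fourPowMul]
        rw [Real.sqrt_mul (by positivity)]
        congr 1
        rw [show (4 : ℝ) ^ n = (2 ^ n) ^ 2 by rw [← pow_mul, mul_comm, pow_mul]; norm_num,
          Real.sqrt_sq (by positivity)]
      have h4 : 2 * C₁ * (Γ.variation f).toReal / (2 ^ n * √α.1) = K * (1 / 2) ^ n := by
        rw [hK, one_div, inv_pow]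
        field_simp
      rw [h2, h3, h4] at h1
      rw [pow_succ]
      linarith
  have hlim : Tendsto (fun n => inner ℝ f (E.approxL (fourPowMul n α) f)
      - inner ℝ f (E.approxL α f)) atTop (𝓝 (inner ℝ f f - inner ℝ f (E.approxL α f))) := by
    refine Tendsto.sub_const (tendsto_const_nhds.inner (E.tendsto_approxL ?_ f)) _
    exact (tendsto_pow_atTop_atTop_of_one_lt (by norm_num : (1 : ℝ) < 4)).atTop_mul_const hα
  have h5 : 4 * C₁ * (Γ.variation f).toReal / √α.1 = 2 * K := by rw [hK]; ring
  rw [h5]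
  refine le_of_tendsto hlim (Eventually.of_forall fun n => (hstep n).trans ?_)
  have : (0 : ℝ) ≤ (1 / 2) ^ n := by positivity
  nlinarith

end Variation

/-! ### The log-Sobolev inequality and the resolvent -/

/-- The tangent bound log(c/t) ≤ c/t - 1 multiplied by 2t². Integrated with a suitable c, it does
the work of Jensen's inequality. -/
theorem sq_mul_log_sq_ge {t c : ℝ} (ht : 0 ≤ t) (hc : 0 < c) :
    2 * (t ^ 2 * Real.log c - c * t + t ^ 2) ≤ t ^ 2 * Real.log (t ^ 2) := by
  rcases ht.eq_or_lt with rfl | ht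
  · simp
  have h1 := Real.log_le_sub_one_of_pos (div_pos hc ht)
  rw [Real.log_div hc.ne' ht.ne'] at h1
  have h2 := mul_le_mul_of_nonneg_left h1 (sq_nonneg t)
  have h3 : t ^ 2 * (c / t - 1) = c * t - t ^ 2 := by field_simp
  rw [h3] at h2
  rw [Real.log_pow]
  push_cast
  linarith

-- Put u = J_α f and F = ‖u‖². The tangent bound with c = F/m and ∫u ≤ m gives ∫u² log u² ≥ 2F
-- log(F/m), so the entropy is at least F(log F - 2 log m). The energy is α(⟪f,u⟫ - F) ≤ α(m - F).
variable {Γ} in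
theorem LogSobolev.norm_sq_approx_mul_log_le {ρ : ℝ} (hρ : 0 < ρ) (h : Γ.LogSobolev ρ)
    (hr : E.IsRegular) (hl : E.IsStrictlyLocal) (α : Set.Ioi (0 : ℝ)) {f : Lp ℝ 2 μ} {m : ℝ}
    (hm : 0 < m) (hf0 : ∀ᵐ x ∂μ, 0 ≤ f x) (hf1 : ∀ᵐ x ∂μ, f x ≤ 1) (hfm : ∫ x, f x ∂μ ≤ m)
    (hfm2 : ‖f‖ ^ 2 ≤ m) (hF : 0 < ‖E.approxL α f‖ ^ 2) :
    ρ * (‖E.approxL α f‖ ^ 2 * (Real.log (‖E.approxL α f‖ ^ 2) - 2 * Real.log m))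
      ≤ α.1 * (m - ‖E.approxL α f‖ ^ 2) := by
  have hα : (0 : ℝ) < α.1 := α.2
  have hub := E.approx_mem_Icc α hf0 hf1
  have hu := DirichletForm.isBounded_approx (E := E) α hf0 hf1
  have hint := E.integral_approx_le α hf0
  have hnorm := E.norm_approx_le α f
  have hE := E.form_approx α f (E.approx α f)
  rw [E.approxL_apply] at hF ⊢
  set u := E.approx α f
  have hsq : ∫ x, (u : Lp ℝ 2 μ) x ^ 2 ∂μ = ‖(u : Lp ℝ 2 μ)‖ ^ 2 := by
    rw [← real_inner_self_eq_norm_sq, inner_eq_integral_mul]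
    simp only [sq]
  obtain ⟨hi, hls⟩ := h u
  rw [hsq, Γ.integral_gamma_of_isBounded hr hl hu hu, hE, inner_sub_left,
    real_inner_self_eq_norm_sq] at hls
  set F := ‖(u : Lp ℝ 2 μ)‖ ^ 2
  have hc : 0 < F / m := div_pos hF hm
  have hui : Integrable (fun x => (u : Lp ℝ 2 μ) x) μ :=
    (Lp.memLp (u : Lp ℝ 2 μ)).integrable one_le_two
  have hu2i : Integrable (fun x => (u : Lp ℝ 2 μ) x ^ 2) μ := (Lp.memLp (u : Lp ℝ 2 μ)).integrable_sq
  have hent : 2 * (F * Real.log (F / m) - F / m * ∫ x, (u : Lp ℝ 2 μ) x ∂μ + F)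
      ≤ ∫ x, (u : Lp ℝ 2 μ) x ^ 2 * Real.log ((u : Lp ℝ 2 μ) x ^ 2) ∂μ := by
    rw [← hsq, ← integral_mul_const, ← integral_const_mul, ← integral_sub, ← integral_add,
      ← integral_const_mul]
    · rw [hsq]
      refine integral_mono_ae ((((hu2i.mul_const _).sub (hui.const_mul _)).add hu2i).const_mul 2)
        hi ?_
      filter_upwards [hub] with x hx using sq_mul_log_sq_ge hx.1 hc
    · exact (hu2i.mul_const _).sub (hui.const_mul _)
    · exact hu2i
    · exact hu2i.mul_const _
    · exact hui.const_mul _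
  have h1 : F / m * ∫ x, (u : Lp ℝ 2 μ) x ∂μ ≤ F := by
    calc _ ≤ F / m * m := by gcongr; exact hint.trans hfm
      _ = F := by field_simp
  have h2 : inner ℝ f (u : Lp ℝ 2 μ) ≤ m := by
    refine (real_inner_le_norm _ _).trans (le_trans ?_ hfm2)
    rw [sq]
    gcongr
  rw [Real.log_div hF.ne' hm.ne'] at hent
  have h3 : F * (Real.log F - 2 * Real.log m) ≤ 1 / ρ * (α.1 * (m - F)) := by
    have h4 : 1 / ρ * (α.1 * (inner ℝ f (u : Lp ℝ 2 μ) - F)) ≤ 1 / ρ * (α.1 * (m - F)) := by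
      gcongr
    linarith
  calc _ ≤ ρ * (1 / ρ * (α.1 * (m - F))) := by gcongr
    _ = _ := by field_simp

/-- If F > 3m/4, then m ≤ 1/2 < (3/4)² gives log F - 2 log m ≥ -(log m)/2. The hypothesis then reads
F/2 ≤ m - F, so F ≤ 2m/3, a contradiction. -/
theorem le_of_mul_log_le {ρ m F : ℝ} (hρ : 0 < ρ) (hm : 0 < m) (hm2 : m ≤ 1 / 2)
    (h : 0 < F → ρ * (F * (Real.log F - 2 * Real.log m)) ≤ ρ * -Real.log m * (m - F)) :
    F ≤ 3 / 4 * m := by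
  by_contra hc
  push Not at hc
  have hF : 0 < F := lt_trans (by positivity) hc
  have h1 := h hF
  rw [mul_assoc] at h1
  have h2 := le_of_mul_le_mul_left h1 hρ
  have h3 : Real.log (3 / 4) + Real.log m ≤ Real.log F := by
    rw [← Real.log_mul (by norm_num) hm.ne']
    exact Real.log_le_log (by positivity) hc.le
  have h4 : Real.log m ≤ 2 * Real.log (3 / 4) := by
    have : Real.log m ≤ Real.log ((3 / 4) ^ 2) := Real.log_le_log hm (hm2.trans (by norm_num))
    rwa [Real.log_pow] at this
  have h5 : Real.log m < 0 := Real.log_neg hm (by linarith)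
  have h6 : F * (-Real.log m / 2) ≤ F * (Real.log F - 2 * Real.log m) := by
    gcongr
    linarith
  have h7 : F * (-Real.log m) ≤ 2 * (m - F) * (-Real.log m) := by linarith
  have h8 := le_of_mul_le_mul_right h7 (by linarith)
  linarith

/-- The isoperimetric inequality for a single set. -/
theorem mul_sqrt_le_perimeter {Γ : CarreDuChamp E} {C₁ ρ : ℝ} (hC₁ : 0 < C₁) (hρ : 0 < ρ)
    (hr : E.IsRegular) (hl : E.IsStrictlyLocal) (hLS : Γ.LogSobolev ρ)
    (hΓ : Γ.WeakBakryEmery C₁ 0) {A : Set X} (hA : MeasurableSet A)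
    (hfin : Γ.perimeter hA < ∞) (hA0 : 0 < μ.real A) (hA1 : μ.real A ≤ 1 / 2) :
    √ρ * (μ.real A * √(-Real.log (μ.real A))) ≤ 32 * C₁ * (Γ.perimeter hA).toReal := by
  set m := μ.real A with hm
  have hL : 0 < -Real.log m := neg_pos.2 (Real.log_neg hA0 (by linarith))
  set f : Lp ℝ 2 μ := indicatorConstLp 2 hA (measure_ne_top μ A) (1 : ℝ) with hfdef
  have hf : ∀ᵐ x ∂μ, 0 ≤ f x ∧ f x ≤ 1 := by
    filter_upwards [indicatorConstLp_coeFn (p := 2) (hs := hA) (hμs := measure_ne_top μ A)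
      (c := (1 : ℝ))] with x hx
    rw [hx]
    exact ⟨Set.indicator_nonneg (fun _ _ => zero_le_one) x,
      Set.indicator_le_self' (fun _ _ => zero_le_one) x⟩
  have hf0 := hf.mono fun _ h => h.1
  have hf1 := hf.mono fun _ h => h.2
  have hfi : ∫ x, f x ∂μ = m := by
    have h1 := integral_indicatorConstLp (p := 2) hA (measure_ne_top μ A) (1 : ℝ)
    rw [smul_eq_mul, mul_one] at h1
    exact h1
  have hff : inner ℝ f f = m := by
    rw [hfdef, L2.inner_indicatorConstLp_one, ← hfdef, ← hfi]
    have h1 := setIntegral_indicatorConstLp (p := 2) hA hA (measure_ne_top μ A) (1 : ℝ)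
    rw [smul_eq_mul, mul_one, Set.inter_self] at h1
    rw [hfi]
    exact h1
  have hfn : ‖f‖ ^ 2 = m := by rw [← real_inner_self_eq_norm_sq, hff]
  -- This scale cancels log m in the entropy bound, so that the loss factor 3/4 does not depend on
  -- m.
  let α : Set.Ioi (0 : ℝ) := ⟨ρ * -Real.log m, Set.mem_Ioi.2 (mul_pos hρ hL)⟩
  have hF : ‖E.approxL α f‖ ^ 2 ≤ 3 / 4 * m := le_of_mul_log_le hρ hA0 hA1 fun h =>
    hLS.norm_sq_approx_mul_log_le hρ hr hl α hA0 hf0 hf1 hfi.le hfn.le h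
  -- Cauchy–Schwarz with ‖f‖² = m, and 3/4 ≤ (7/8)². The remaining gap m/8 against 4C₁ yields the
  -- constant 32C₁.
  have h1 : inner ℝ f (E.approxL α f) ≤ 7 / 8 * m := by
    refine (real_inner_le_norm _ _).trans (le_of_sq_le_sq ?_ (by positivity))
    rw [mul_pow, hfn]
    nlinarith [sq_nonneg m]
  have h2 := hΓ.inner_self_sub_le hC₁ hr hl α hf0 hf1 hfin
  rw [hff, le_div_iff₀ (Real.sqrt_pos.2 α.2), Real.sqrt_mul hρ.le] at h2
  have h3 : 1 / 8 * m * (√ρ * √(-Real.log m))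
      ≤ (m - inner ℝ f (E.approxL α f)) * (√ρ * √(-Real.log m)) := by
    gcongr
    linarith
  have h4 : Γ.perimeter hA = Γ.variation f := rfl
  rw [h4]
  linarith

end CarreDuChamp

/-! ### Passage to the infimum over sets and the supremum over ρ -/

open CarreDuChamp in
theorem mainTheorem11 (C₁ : ℝ) (hC₁ : 1 ≤ C₁) :
    ∃ C : ℝ, 0 < C ∧
      ∀ (X : Type u) [MetricSpace X] [CompactSpace X] [MeasurableSpace X] [BorelSpace X]
        (μ : Measure X) [IsProbabilityMeasure μ] [μ.IsOpenPosMeasure]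
        (E : DirichletForm μ) (Γ : CarreDuChamp E),
        E.IsRegular → E.IsStrictlyLocal →
        (∃ ρ : ℝ, 0 < ρ ∧ Γ.LogSobolev ρ) →
        Γ.WeakBakryEmery C₁ 0 →
        Γ.logSobolevConstant ≤ ENNReal.ofReal C * Γ.gaussianIsoperimetricConstant ^ 2 := by
  have hC0 : 0 < C₁ := by linarith
  refine ⟨(32 * C₁) ^ 2, by positivity, ?_⟩
  intro X _ _ _ _ μ _ _ E Γ hr hl _ hΓ
  refine iSup_le fun ρ => iSup₂_le fun hρ hLS => ?_
  have hk : ENNReal.ofReal (√ρ / (32 * C₁)) ≤ Γ.gaussianIsoperimetricConstant := by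
    refine le_iInf₂ fun A hA => le_iInf₂ fun hfin hA0 => le_iInf fun hA1 => ?_
    have hm0 : 0 < μ.real A := ENNReal.toReal_pos hA0.ne' (measure_ne_top μ A)
    have hm1 : μ.real A ≤ 1 / 2 := by
      have := ENNReal.toReal_mono (by simp) hA1
      simpa [Measure.real] using this
    have h := mul_sqrt_le_perimeter hC0 hρ hr hl hLS hΓ hA hfin hm0 hm1
    have hL : 0 < √(-Real.log (μ.real A)) :=
      Real.sqrt_pos.2 (neg_pos.2 (Real.log_neg hm0 (by linarith)))
    have hden : μ A * ENNReal.ofReal (√(-Real.log (μ A).toReal))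
        = ENNReal.ofReal (μ.real A * √(-Real.log (μ.real A))) := by
      rw [ENNReal.ofReal_mul hm0.le, ofReal_measureReal (measure_ne_top μ A)]
      rfl
    rw [hden, ENNReal.le_div_iff_mul_le
      (Or.inl (ENNReal.ofReal_pos.2 (mul_pos hm0 hL)).ne') (Or.inl ENNReal.ofReal_ne_top),
      ← ENNReal.ofReal_mul (by positivity), ENNReal.ofReal_le_iff_le_toReal hfin.ne,
      div_mul_eq_mul_div, div_le_iff₀ (by positivity)]
    linarith
  calc ENNReal.ofReal ρ = ENNReal.ofReal ((32 * C₁) ^ 2) * ENNReal.ofReal (√ρ / (32 * C₁)) ^ 2 := by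
        rw [← ENNReal.ofReal_pow (by positivity), ← ENNReal.ofReal_mul (by positivity), div_pow,
          Real.sq_sqrt hρ.le]
        congr 1
        field_simp
    _ ≤ _ := by gcongr
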